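/- Let $V$ be a finite-dimensional complex vector space, $G\subset \mathrm{GL}(V)$ a finite subgroup, and $R=\{r\in G : \operatorname{codim}\ker(r-1)=1\}$ its set of reflections. Let $c_r\in\mathbb{C}$ $(r\in R)$ be numbers with $c_{grg^{-1}}=c_r$ for all $g\in G$, $r\in R$, and for $r\in R$ let $\alpha_r\in V^*$ be a linear form with kernel $\ker(r-1)$. The rational Cherednik algebra $H_c=H_c(G,V)$ is the subalgebra of $\mathrm{End}_{\mathbb{C}}(\mathbb{C}[V])$ generated by $\mathbb{C}[V]$ (acting by multiplication), by $G$ (acting by $(gf)(v)=f(g^{-1}v)$), and by the Dunkl operators $$f\mapsto \partial_y f-\sum_{r\in R}c_r\,\langle\alpha_r,y\rangle\,\frac{f-r(f)}{\alpha_r},\qquad y\in V.$$ For an irreducible complex representation $S^\lambda$ of $G$, let $c_\lambda$ be the scalar by which $\sum_{r\in R}c_r(1-r)$ acts on $S^\lambda$, let $\Delta_c(\lambda)$ be the $H_c$-module induced from $S^\lambda$, regarded as a module over the subalgebra generated by $G$ and the Dunkl operators on which the Dunkl operators act by $0$, and let $L_c(\lambda)=\Delta_c(\lambda)/\mathrm{Rad}(\Delta_c(\lambda))$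 be its irreducible quotient. If $L_c(\lambda)$ is finite dimensional, then for every nonzero $v\in V$, with stabilizer $G_S=\{g\in G : gv=v\}$ (where $S=\mathbb{C}^\times v$), the restriction $\mathrm{Res}^G_{G_S}S^\lambda$ belongs to the Serre subcategory of the category of finitely generated $\mathbb{C}G_S$-modules generated by the modules $\mathrm{Res}^G_{G_S}S^\mu$, where $S^\mu$ runs over the irreducible representations of $G$ with $c_\mu-c_\lambda\in\mathbb{Z}_{>0}$. -/

import Mathlib

open CategoryTheory TensorProduct

noncomputable section

namespace Cherednik

section Polynomials

variable {V : Type*} [AddCommGroup V] [Module ℂ V]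

/-- The algebra `ℂ[V] = Sym(V*)` of polynomial functions on `V`. -/
def Poly (V : Type*) [AddCommGroup V] [Module ℂ V] : Type _ :=
  SymmetricAlgebra ℂ (Module.Dual ℂ V)

instance : CommRing (Poly V) := inferInstanceAs (CommRing (SymmetricAlgebra ℂ (Module.Dual ℂ V)))

instance : Algebra ℂ (Poly V) :=
  inferInstanceAs (Algebra ℂ (SymmetricAlgebra ℂ (Module.Dual ℂ V)))

instance : IsDomain (Poly V) :=
  inferInstanceAs (IsDomain (SymmetricAlgebra ℂ (Module.Dual ℂ V)))

/-- Linear forms, regarded as polynomial functions. -/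
def coord : Module.Dual ℂ V →ₗ[ℂ] Poly V := SymmetricAlgebra.ι ℂ (Module.Dual ℂ V)

/-- The algebra map out of `ℂ[V]` with prescribed values on linear forms. -/
def polyLift {A : Type*} [CommRing A] [Algebra ℂ A] (φ : Module.Dual ℂ V →ₗ[ℂ] A) :
    Poly V →ₐ[ℂ] A :=
  SymmetricAlgebra.lift φ

@[simp]
theorem polyLift_coord {A : Type*} [CommRing A] [Algebra ℂ A] (φ : Module.Dual ℂ V →ₗ[ℂ] A)
    (x : Module.Dual ℂ V) : polyLift φ (coord x) = φ x :=
  SymmetricAlgebra.lift_ι_apply φ x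

theorem poly_hom_ext {A : Type*} [CommRing A] [Algebra ℂ A] {φ ψ : Poly V →ₐ[ℂ] A}
    (h : ∀ x, φ (coord x) = ψ (coord x)) : φ = ψ :=
  SymmetricAlgebra.algHom_ext (LinearMap.ext h)

theorem poly_induction {motive : Poly V → Prop}
    (algebraMap : ∀ z, motive (algebraMap ℂ (Poly V) z)) (coord : ∀ x, motive (coord x))
    (mul : ∀ a b, motive a → motive b → motive (a * b))
    (add : ∀ a b, motive a → motive b → motive (a + b)) (f : Poly V) : motive f :=
  SymmetricAlgebra.induction _ _ (motive := motive) algebraMap coord mul add f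

/-- The action of `GL(V)` on `ℂ[V]`, `(g f)(v) = f (g⁻¹ v)`: the algebra map that extends
`x ↦ x ∘ g⁻¹` on linear forms. -/
def polyAct (g : V ≃ₗ[ℂ] V) : Poly V →ₐ[ℂ] Poly V :=
  polyLift
    (coord ∘ₗ LinearMap.dualMap (g⁻¹ : V ≃ₗ[ℂ] V).toLinearMap)

/-- The algebra map `f ↦ f + ε ∂_y f` into the dual numbers over `ℂ[V]`, which sends a linear
form `x` to `x + ε x(y)`. -/
def taylor (y : V) : Poly V →ₐ[ℂ] TrivSqZeroExt (Poly V) (Poly V) :=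
  polyLift
    (((TrivSqZeroExt.inlAlgHom ℂ (Poly V) (Poly V)).toLinearMap ∘ₗ coord) +
        ((TrivSqZeroExt.inrHom (Poly V) (Poly V)).restrictScalars ℂ ∘ₗ
          Algebra.linearMap ℂ (Poly V) ∘ₗ Module.Dual.eval ℂ V y))

/-- The directional derivative `∂_y` on `ℂ[V]`. -/
def pderiv (y : V) : Module.End ℂ (Poly V) :=
  (TrivSqZeroExt.sndHom (Poly V) (Poly V)).restrictScalars ℂ ∘ₗ (taylor y).toLinearMap

theorem pderiv_coord (y : V) (x : Module.Dual ℂ V) :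
    pderiv y (coord x) = algebraMap ℂ (Poly V) (x y) := by
  simp [pderiv, taylor, Algebra.algebraMap_eq_smul_one]

theorem pderiv_mul (y : V) (f h : Poly V) :
    pderiv y (f * h) = f * pderiv y h + pderiv y f * h := by
  have key : (TrivSqZeroExt.fstHom ℂ (Poly V) (Poly V)).comp (taylor y) = AlgHom.id ℂ _ := by
    apply poly_hom_ext
    intro x
    simp [taylor]
  have h1 : ∀ f, (taylor y f).fst = f := fun f => by
    simpa using DFunLike.congr_fun key f
  simp [pderiv, h1, mul_comm]

/-- The fixed space of `g` on `V`. -/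
def fixedSpace (g : V ≃ₗ[ℂ] V) : Submodule ℂ V :=
  LinearMap.ker (g.toLinearMap - LinearMap.id)

/-- A reflection: the fixed space has codimension exactly one. -/
def IsReflection (g : V ≃ₗ[ℂ] V) : Prop :=
  Module.finrank ℂ (V ⧸ fixedSpace g) = 1

theorem exists_form {g : V ≃ₗ[ℂ] V} (hg : IsReflection g) :
    ∃ α : Module.Dual ℂ V, LinearMap.ker α = fixedSpace g := by
  have : Module.Finite ℂ (V ⧸ fixedSpace g) :=
    Module.finite_of_finrank_pos (by rw [hg]; exact one_pos)
  let e : (V ⧸ fixedSpace g) ≃ₗ[ℂ] ℂ :=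
    LinearEquiv.ofFinrankEq _ _ (by rw [hg]; simp)
  exact ⟨e.toLinearMap ∘ₗ (fixedSpace g).mkQ, by simp [LinearMap.ker_comp]⟩

end Polynomials

section Data

variable {V : Type*} [AddCommGroup V] [Module ℂ V]

/-- The set `R` of reflections in `G`. -/
abbrev Refl (G : Subgroup (V ≃ₗ[ℂ] V)) : Type _ :=
  {r : G // IsReflection (r : V ≃ₗ[ℂ] V)}

instance (G : Subgroup (V ≃ₗ[ℂ] V)) [Finite G] : Fintype (Refl G) := Fintype.ofFinite _

theorem isReflection_conj {G : Subgroup (V ≃ₗ[ℂ] V)} (g r : G)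
    (hr : IsReflection (r : V ≃ₗ[ℂ] V)) :
    IsReflection ((g * r * g⁻¹ : G) : V ≃ₗ[ℂ] V) := by
  have h : (fixedSpace (r : V ≃ₗ[ℂ] V)).map (g : V ≃ₗ[ℂ] V).toLinearMap =
      fixedSpace ((g * r * g⁻¹ : G) : V ≃ₗ[ℂ] V) := by
    ext w
    rw [Submodule.mem_map_equiv]
    have h1 : (g : V ≃ₗ[ℂ] V)⁻¹ w = (g : V ≃ₗ[ℂ] V).symm w := rfl
    simp [fixedSpace, sub_eq_zero, h1, ← LinearEquiv.eq_symm_apply]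
  rw [IsReflection,
    ← (Submodule.Quotient.equiv _ _ (g : V ≃ₗ[ℂ] V) h).finrank_eq]
  exact hr

/-- A parameter `c`: numbers `c_r` for `r ∈ R` with `c_r = c_{g r g⁻¹}` for `g ∈ G`. -/
structure Param (G : Subgroup (V ≃ₗ[ℂ] V)) where
  val : Refl G → ℂ
  conj : ∀ (g : G) (r s : Refl G), s.1 = g * r.1 * g⁻¹ → val s = val r

variable {G : Subgroup (V ≃ₗ[ℂ] V)}

/-- A linear form `α_r` whose kernel is the reflecting hyperplane of `r`. -/
def form (r : Refl G) : Module.Dual ℂ V := Classical.choose (exists_form r.2)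

theorem ker_form (r : Refl G) : LinearMap.ker (form r) = fixedSpace (r.1 : V ≃ₗ[ℂ] V) :=
  Classical.choose_spec (exists_form r.2)

theorem form_ne_zero (r : Refl G) : form r ≠ 0 := by
  intro h
  have h1 := ker_form r
  have h2 := r.2
  rw [h, LinearMap.ker_zero] at h1
  rw [IsReflection, ← h1] at h2
  simp [Module.finrank_zero_of_subsingleton] at h2

theorem coord_form_ne_zero (r : Refl G) : coord (form r) ≠ 0 := by
  intro h
  obtain ⟨y, hy⟩ : ∃ y, form r y ≠ 0 := by
    by_contra! h'
    exact form_ne_zero r (LinearMap.ext h')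
  have h1 := pderiv_coord y (form r)
  rw [h, map_zero] at h1
  exact hy ((map_eq_zero_iff _ (algebraMap ℂ (Poly V)).injective).1 h1.symm)

theorem form_dvd (r : Refl G) (f : Poly V) :
    coord (form r) ∣ f - polyAct (r.1 : V ≃ₗ[ℂ] V) f := by
  induction f using poly_induction with
  | algebraMap z => simp
  | coord x =>
    have hx : ∃ z : ℂ, z • form r = x - LinearMap.dualMap
        ((r.1 : V ≃ₗ[ℂ] V)⁻¹ : V ≃ₗ[ℂ] V).toLinearMap x := by
      rw [← Submodule.mem_span_singleton, ← Set.range_const (ι := Unit)]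
      apply mem_span_of_iInf_ker_le_ker (L := fun _ : Unit => form r)
      intro w hw
      have hw' : (r.1 : V ≃ₗ[ℂ] V) w = w := by
        have : w ∈ fixedSpace (r.1 : V ≃ₗ[ℂ] V) := by
          rw [← ker_form]; simpa using hw
        simpa [fixedSpace, sub_eq_zero] using this
      have hw2 : (r.1 : V ≃ₗ[ℂ] V)⁻¹ w = w := by
        rw [← LinearEquiv.smul_def, inv_smul_eq_iff]; exact hw'.symm
      simp [LinearMap.dualMap_apply, hw2]
    obtain ⟨z, hz⟩ := hx
    refine ⟨algebraMap ℂ _ z, ?_⟩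
    rw [mul_comm, ← Algebra.smul_def, ← map_smul, hz, map_sub]
    simp [polyAct]
  | mul a b ha hb =>
    have : a * b - polyAct (r.1 : V ≃ₗ[ℂ] V) (a * b) =
        (a - polyAct (r.1 : V ≃ₗ[ℂ] V) a) * b +
          polyAct (r.1 : V ≃ₗ[ℂ] V) a * (b - polyAct (r.1 : V ≃ₗ[ℂ] V) b) := by
      rw [map_mul]; ring
    rw [this]
    exact dvd_add (ha.mul_right _) (hb.mul_left _)
  | add a b ha hb =>
    rw [map_add, add_sub_add_comm]
    exact dvd_add ha hb

/-- The operator `f ↦ (f - r(f)) / α_r` on `ℂ[V]`. -/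
def divDiff (r : Refl G) : Module.End ℂ (Poly V) where
  toFun f := Classical.choose (form_dvd r f)
  map_add' f h := by
    apply mul_left_cancel₀ (coord_form_ne_zero r)
    rw [mul_add, ← Classical.choose_spec (form_dvd r f), ← Classical.choose_spec (form_dvd r h),
      ← Classical.choose_spec (form_dvd r (f + h)), map_add, add_sub_add_comm]
  map_smul' z f := by
    apply mul_left_cancel₀ (coord_form_ne_zero r)
    rw [RingHom.id_apply, mul_smul_comm, ← Classical.choose_spec (form_dvd r f),
      ← Classical.choose_spec (form_dvd r (z • f)), map_smul, smul_sub]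

theorem form_mul_divDiff (r : Refl G) (f : Poly V) :
    coord (form r) * divDiff r f = f - polyAct (r.1 : V ≃ₗ[ℂ] V) f :=
  (Classical.choose_spec (form_dvd r f)).symm

variable [Finite G] (c : Param G)

/-- The Dunkl operator `y(f) = ∂_y f - ∑_r c_r ⟨α_r, y⟩ (f - r(f)) / α_r`. -/
def dunkl (y : V) : Module.End ℂ (Poly V) :=
  pderiv y - ∑ r : Refl G, (c.val r * form r y) • divDiff r

/-- The rational Cherednik algebra `H_c(G, V)`: the algebra of operators on `ℂ[V]` generated by
the multiplication operators, the group `G` and the Dunkl operators. -/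
def rca : Subalgebra ℂ (Module.End ℂ (Poly V)) :=
  Algebra.adjoin ℂ
    (Set.range (fun f : Poly V => LinearMap.mulLeft ℂ f) ∪
      Set.range (fun g : G => (polyAct (g : V ≃ₗ[ℂ] V)).toLinearMap) ∪
      Set.range (dunkl c))

/-- `H_c(G, V)` as a type. -/
def RCA : Type _ := rca c

instance : Ring (RCA c) := inferInstanceAs (Ring (rca c))

instance : Algebra ℂ (RCA c) := inferInstanceAs (Algebra ℂ (rca c))

/-- An element of `G`, in `H_c(G, V)`. -/
def groupElt (g : G) : RCA c :=
  ⟨(polyAct (g : V ≃ₗ[ℂ] V)).toLinearMap,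
    Algebra.subset_adjoin (Or.inl (Or.inr ⟨g, rfl⟩))⟩

/-- A Dunkl operator, in `H_c(G, V)`. -/
def dunklElt (y : V) : RCA c :=
  ⟨dunkl c y, Algebra.subset_adjoin (Or.inr ⟨y, rfl⟩)⟩

section Modules

variable {W : Type*} [AddCommGroup W] [Module ℂ W] (ρ : Representation ℂ G W)

/-- The relations of the module induced to `H_c(G, V)` from `W`, where `W` is inflated to the
subalgebra generated by `G` and the Dunkl operators by letting the Dunkl operators act by `0`:
`g ⊗ u = 1 ⊗ g u` for `g ∈ G` and `y ⊗ u = 0` for `y ∈ V`. -/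
def standardRel : Submodule (RCA c) (RCA c ⊗[ℂ] W) :=
  Submodule.span (RCA c)
    ({t | ∃ (g : G) (u : W), t = groupElt c g ⊗ₜ[ℂ] u - (1 : RCA c) ⊗ₜ[ℂ] ρ g u} ∪
      {t | ∃ (y : V) (u : W), t = dunklElt c y ⊗ₜ[ℂ] u})

/-- The standard module `Δ_c(W)`: the module induced from the inflation of `W`. -/
abbrev Standard : Type _ := (RCA c ⊗[ℂ] W) ⧸ standardRel c ρ

/-- `L_c(W) = Δ_c(W) / Rad Δ_c(W)`. -/
abbrev Irred : Type _ := Standard c ρ ⧸ Module.jacobson (RCA c) (Standard c ρ)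

/-- The action of `∑_r c_r (1 - r)` on a representation of `G`. -/
def reflSum : Module.End ℂ W := ∑ r : Refl G, c.val r • (1 - ρ r.1)

theorem reflSum_comm (g : G) : reflSum c ρ * ρ g = ρ g * reflSum c ρ := by
  let e : Refl G ≃ Refl G :=
    { toFun := fun r => ⟨g * r.1 * g⁻¹, isReflection_conj g r.1 r.2⟩
      invFun := fun r => ⟨g⁻¹ * r.1 * g, by simpa using isReflection_conj g⁻¹ r.1 r.2⟩
      left_inv := fun r => Subtype.ext (by simp [mul_assoc])
      right_inv := fun r => Subtype.ext (by simp [mul_assoc]) }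
  rw [reflSum, Finset.sum_mul, Finset.mul_sum, ← e.sum_comp]
  refine Finset.sum_congr rfl fun r _ => ?_
  rw [c.conj g r (e r) rfl, smul_mul_assoc, mul_smul_comm, sub_mul, mul_sub, one_mul, mul_one,
    ← map_mul, ← map_mul]
  simp [e, mul_assoc]

/-- On an irreducible representation, `∑_r c_r (1 - r)` acts by a scalar. -/
theorem exists_cValue [FiniteDimensional ℂ W] (hρ : ρ.IsIrreducible) :
    ∃ z : ℂ, reflSum c ρ = z • 1 := by
  let f : Representation.IntertwiningMap ρ ρ :=
    { reflSum c ρ with isIntertwining' := reflSum_comm c ρ }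
  obtain ⟨z, hz⟩ :=
    (Representation.IsIrreducible.algebraMap_intertwiningMap_bijective_of_isAlgClosed (ρ := ρ)).2 f
  refine ⟨z, LinearMap.ext fun u => ?_⟩
  have := DFunLike.congr_fun hz u
  change f u = _
  simpa [Algebra.algebraMap_eq_smul_one] using this.symm

/-- The scalar by which `∑_r c_r (1 - r)` acts on an irreducible representation. -/
def cValue [FiniteDimensional ℂ W] (hρ : ρ.IsIrreducible) : ℂ :=
  Classical.choose (exists_cValue c ρ hρ)

theorem cValue_spec [FiniteDimensional ℂ W] (hρ : ρ.IsIrreducible) :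
    reflSum c ρ = cValue c ρ hρ • 1 :=
  Classical.choose_spec (exists_cValue c ρ hρ)

end Modules

end Data

/-- The Serre subcategory of an abelian category generated by a class `Q` of objects: the
intersection of all Serre subcategories that contain `Q`. -/
def serreClosure {C : Type*} [Category C] [Abelian C] (Q : ObjectProperty C) :
    ObjectProperty C :=
  fun X => ∀ P : ObjectProperty C, P.IsSerreClass → Q ≤ P → P X

/-- Restriction of a finite dimensional representation to a subgroup. -/
abbrev res {G : Type*} [Group G] (H : Subgroup G) (S : FDRep ℂ G) : FDRep ℂ H :=
  (Action.res (FGModuleCat ℂ) H.subtype).obj S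

end Cherednik

end

/-!
The commutator of a Dunkl operator `y` with an invariant `p ∈ ℂ[V]^G` is `∂_y p`, so iterated
commutators with `p` send an operator to its top symbol evaluated at `dp`. At a point with trivial
stabilizer, `dp` takes every value; together with the linear independence of the elements of `G`
over `ℂ[V]`, this gives the PBW theorem for `H_c`, and `Δ_c(W) = ℂ[V] ⊗ W` follows.

Let `κ = c_λ`, let `N` be the radical of `Δ_c(λ)`, and let `N_d = N ∩ (ℂ[V]_d ⊗ S^λ)`. The Euler
element `∑ᵢ xᵢ yᵢ + ∑_r c_r (1 - r)` acts on `ℂ[V]_d ⊗ S^λ` by `κ + d`. It has only finitely many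
eigenvalues on the finite dimensional quotient `Δ_c(λ) / N`, so `N` contains `ℂ[V]_d ⊗ S^λ` for some
`d`, and since `v ≠ 0`, the values at `v` of its elements fill `S^λ`. On the other hand `N_0 = 0`,
because `N` is proper and `S^λ` is irreducible.

Let `F_d ⊆ S^λ` be the space of values at `v` of `N_d`; it is stable under `G_S`, and
`F_d ⊆ F_{d+1}`. For `m ∈ N_{d+1}` each `yᵢ m` lies in `N_d`, so the Euler element shows that
`∑_r c_r (1 - r) m` and `(κ + d + 1) m` have the same value at `v` modulo `F_d`. Therefore
`F_{d+1} / F_d` is a quotient of the restriction to `G_S` of a representation of `G` on which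
`∑_r c_r (1 - r)` acts by `κ + d + 1`, and induction on `d` puts every `F_d` in the Serre
subcategory.
-/

noncomputable section

namespace Cherednik

section PolynomialFunctions

variable {V : Type*} [AddCommGroup V] [Module ℂ V]

/-- Evaluation of polynomial functions at the point `b`. -/
def polyEval (b : V) : Poly V →ₐ[ℂ] ℂ := polyLift (Module.Dual.eval ℂ V b)

@[simp]
theorem polyEval_coord (b : V) (x : Module.Dual ℂ V) : polyEval b (coord x) = x b := by
  simp [polyEval]

theorem eq_zero_of_polyEval [FiniteDimensional ℂ V] {f : Poly V} (h : ∀ b, polyEval b f = 0) :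
    f = 0 := by
  let B := Module.finBasis ℂ V
  let e : Poly V ≃ₐ[ℂ] MvPolynomial _ ℂ := SymmetricAlgebra.equivMvPolynomial B.dualBasis
  have aeval_equiv (t : Fin (Module.finrank ℂ V) → ℂ) :
      (MvPolynomial.aeval t).comp e.toAlgHom = polyEval (B.equivFun.symm t) := by
    refine poly_hom_ext fun x => ?_
    suffices ((MvPolynomial.aeval t).comp e.toAlgHom).toLinearMap ∘ₗ coord =
        (polyEval (B.equivFun.symm t)).toLinearMap ∘ₗ coord from LinearMap.congr_fun this x
    refine B.dualBasis.ext fun i => ?_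
    have he : e (coord (B.dualBasis i)) = MvPolynomial.X i :=
      SymmetricAlgebra.equivMvPolynomial_ι_apply _ i
    rw [Module.Basis.coe_dualBasis] at he
    simp [he, Finsupp.single_apply]
  refine e.injective (MvPolynomial.funext fun t => ?_)
  simpa [h] using DFunLike.congr_fun (aeval_equiv t) f

@[simp]
theorem polyAct_coord (g : V ≃ₗ[ℂ] V) (x : Module.Dual ℂ V) :
    polyAct g (coord x) = coord (x ∘ₗ (g⁻¹ : V ≃ₗ[ℂ] V).toLinearMap) := by
  simp [polyAct, LinearMap.dualMap_apply']

theorem polyAct_mul (g h : V ≃ₗ[ℂ] V) : polyAct (g * h) = (polyAct g).comp (polyAct h) :=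
  poly_hom_ext fun x => by
    rw [AlgHom.comp_apply, polyAct_coord, polyAct_coord, polyAct_coord, mul_inv_rev]
    rfl

theorem polyAct_one : polyAct (1 : V ≃ₗ[ℂ] V) = AlgHom.id ℂ (Poly V) :=
  poly_hom_ext fun x => by simp

theorem polyAct_injective : Function.Injective (polyAct (V := V)) := fun g h hgh => by
  refine inv_injective (LinearEquiv.ext fun b => ?_)
  rw [← sub_eq_zero, ← Module.forall_dual_apply_eq_zero_iff ℂ]
  intro x
  rw [map_sub, sub_eq_zero]
  simpa using congrArg (fun φ : Poly V →ₐ[ℂ] Poly V => polyEval b (φ (coord x))) hgh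

theorem polyEval_comp_polyAct (g : V ≃ₗ[ℂ] V) (b : V) :
    (polyEval b).comp (polyAct g) = polyEval (g⁻¹ b) :=
  poly_hom_ext fun x => by simp

theorem polyEval_polyAct (g : V ≃ₗ[ℂ] V) (b : V) (f : Poly V) :
    polyEval b (polyAct g f) = polyEval (g⁻¹ b) f :=
  DFunLike.congr_fun (polyEval_comp_polyAct g b) f

@[simp]
theorem pderiv_algebraMap (y : V) (z : ℂ) : pderiv y (algebraMap ℂ (Poly V) z) = 0 := by
  have h : pderiv y (1 : Poly V) = 0 := by simpa using pderiv_mul y 1 1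
  rw [Algebra.algebraMap_eq_smul_one, map_smul, h, smul_zero]

theorem pderiv_add (y z : V) (f : Poly V) : pderiv (y + z) f = pderiv y f + pderiv z f := by
  induction f using poly_induction with
  | algebraMap a => simp
  | coord x => simp [pderiv_coord]
  | mul a b ha hb => simp only [pderiv_mul, ha, hb]; ring
  | add a b ha hb => simp only [map_add, ha, hb]; ring

theorem pderiv_smul (t : ℂ) (y : V) (f : Poly V) : pderiv (t • y) f = t • pderiv y f := by
  induction f using poly_induction with
  | algebraMap a => simp
  | coord x => simp [pderiv_coord, Algebra.smul_def]
  | mul a b ha hb => simp only [pderiv_mul, ha, hb, Algebra.smul_def]; ring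
  | add a b ha hb => simp only [map_add, ha, hb, smul_add]

theorem polyAct_pderiv (g : V ≃ₗ[ℂ] V) (y : V) (f : Poly V) :
    polyAct g (pderiv y f) = pderiv (g y) (polyAct g f) := by
  induction f using poly_induction with
  | algebraMap a => simp
  | coord x => simp [pderiv_coord]
  | mul a b ha hb => simp only [pderiv_mul, map_mul, map_add, ha, hb]
  | add a b ha hb => simp only [map_add, ha, hb]

/-- The polynomial functions that are homogeneous of degree `d`. -/
def homog (V : Type*) [AddCommGroup V] [Module ℂ V] (d : ℕ) : Submodule ℂ (Poly V) :=
  LinearMap.range (coord : Module.Dual ℂ V →ₗ[ℂ] Poly V) ^ d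

theorem mem_homog_zero {f : Poly V} : f ∈ homog V 0 ↔ ∃ z, algebraMap ℂ (Poly V) z = f := by
  rw [homog, pow_zero, Submodule.mem_one]

theorem mul_mem_homog {d e : ℕ} {f h : Poly V} (hf : f ∈ homog V d) (hh : h ∈ homog V e) :
    f * h ∈ homog V (d + e) := by
  rw [homog, pow_add]
  exact Submodule.mul_mem_mul hf hh

theorem coord_mul_mem_homog (x : Module.Dual ℂ V) {d : ℕ} {f : Poly V} (hf : f ∈ homog V d) :
    coord x * f ∈ homog V (d + 1) := by
  rw [homog, pow_succ']
  exact Submodule.mul_mem_mul ⟨x, rfl⟩ hf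

theorem homog_fg [FiniteDimensional ℂ V] (d : ℕ) : (homog V d).FG := by
  refine Submodule.FG.pow ?_ d
  rw [LinearMap.range_eq_map]
  exact Module.Finite.fg_top.map _

theorem polyAct_mem_homog (g : V ≃ₗ[ℂ] V) {d : ℕ} {f : Poly V} (hf : f ∈ homog V d) :
    polyAct g f ∈ homog V d := by
  suffices (homog V d).map (polyAct g).toLinearMap ≤ homog V d from this ⟨f, hf, rfl⟩
  rw [homog, Submodule.map_pow]
  refine pow_le_pow_left' ?_ d
  rintro _ ⟨_, ⟨x, rfl⟩, rfl⟩
  exact ⟨_, (polyAct_coord g x).symm⟩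

theorem homog_succ_le_comap {D τ : Module.End ℂ (Poly V)}
    (hτ : ∀ d, ∀ f ∈ homog V d, τ f ∈ homog V d)
    (hmul : ∀ f h, D (f * h) = D f * τ h + f * D h)
    (hcoord : ∀ x, D (coord x) ∈ homog V 0) (d : ℕ) :
    homog V (d + 1) ≤ (homog V d).comap D := by
  induction d with
  | zero =>
    rw [homog, zero_add, pow_one]
    rintro _ ⟨x, rfl⟩
    exact hcoord x
  | succ d ih =>
    rw [homog, pow_succ', Submodule.mul_le]
    rintro _ ⟨x, rfl⟩ f hf
    rw [Submodule.mem_comap, hmul]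
    refine add_mem ?_ (coord_mul_mem_homog x (ih hf))
    simpa only [zero_add] using mul_mem_homog (hcoord x) (hτ _ f hf)

theorem pderiv_mem_homog (y : V) {d : ℕ} {f : Poly V} (hf : f ∈ homog V (d + 1)) :
    pderiv y f ∈ homog V d :=
  homog_succ_le_comap (τ := LinearMap.id) (fun _ _ h => h)
    (fun f h => by rw [pderiv_mul, add_comm, LinearMap.id_apply])
    (fun x => mem_homog_zero.2 ⟨x y, (pderiv_coord y x).symm⟩) d hf

section Basis

variable {ι : Type*} [Fintype ι] (b : Module.Basis ι ℂ V)

theorem sum_smul_coord (x : Module.Dual ℂ V) :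
    ∑ i, x (b i) • coord (b.coord i) = coord x := by
  simp only [← map_smul, ← map_sum]
  rw [b.sum_dual_apply_smul_coord]

theorem sum_coord_mul_pderiv {d : ℕ} {f : Poly V} (hf : f ∈ homog V d) :
    ∑ i, coord (b.coord i) * pderiv (b i) f = (d : ℂ) • f := by
  induction hf using Submodule.pow_induction_on_left' with
  | algebraMap z => simp
  | add f h d _ _ ihf ihh =>
    simp only [map_add, mul_add, Finset.sum_add_distrib, ihf, ihh, smul_add]
  | mem_mul x hx d f _ ih =>
    obtain ⟨x, rfl⟩ := hx
    have hsum : ∑ i, coord (b.coord i) * algebraMap ℂ (Poly V) (x (b i)) = coord x := by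
      simp only [mul_comm _ (algebraMap ℂ (Poly V) _), ← Algebra.smul_def, sum_smul_coord]
    simp only [pderiv_mul, pderiv_coord, mul_add, Finset.sum_add_distrib, mul_left_comm _ (coord x),
      ← mul_assoc, ← Finset.sum_mul]
    simp only [mul_assoc, ← Finset.mul_sum, ih, hsum]
    rw [mul_smul_comm, Nat.cast_succ, add_smul, one_smul]

end Basis

end PolynomialFunctions

section RegularPoints

variable {V : Type*} [AddCommGroup V] [Module ℂ V]

theorem exists_polyEval_eq_one_of_notMem (s : Finset V) {b : V} (hb : b ∉ s) :
    ∃ q : Poly V, polyEval b q = 1 ∧ ∀ w ∈ s, polyEval w q = 0 := by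
  have separating (w : V) : ∃ x : Module.Dual ℂ V, w ∈ s → x (b - w) = 1 := by
    by_cases hw : w ∈ s
    · have hne : b - w ≠ 0 := sub_ne_zero.2 fun h => hb (h ▸ hw)
      obtain ⟨x, hx⟩ := Module.Projective.exists_dual_ne_zero ℂ hne
      exact ⟨(x (b - w))⁻¹ • x, fun _ => inv_mul_cancel₀ hx⟩
    · exact ⟨0, fun h => absurd h hw⟩
  choose x hx using separating
  refine ⟨∏ w ∈ s, (coord (x w) - algebraMap ℂ (Poly V) (x w w)), ?_, fun w hw => ?_⟩
  · rw [map_prod]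
    exact Finset.prod_eq_one fun w hw => by simpa using hx w hw
  · rw [map_prod]
    exact Finset.prod_eq_zero hw (by simp)

theorem exists_polyEval_ne_zero_of_stabilizer_eq_one [FiniteDimensional ℂ V]
    (G : Subgroup (V ≃ₗ[ℂ] V)) [Finite G] {f : Poly V} (hf : f ≠ 0) :
    ∃ b : V, polyEval b f ≠ 0 ∧ ∀ g : G, (g : V ≃ₗ[ℂ] V) b = b → g = 1 := by
  classical
  have := Fintype.ofFinite G
  have exists_covector (g : G) : ∃ x : Module.Dual ℂ V, g ≠ 1 →
      x ≠ 0 ∧ fixedSpace (g : V ≃ₗ[ℂ] V) ≤ LinearMap.ker x := by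
    by_cases hg : g = 1
    · exact ⟨0, fun h => absurd hg h⟩
    have hlt : fixedSpace (g : V ≃ₗ[ℂ] V) < ⊤ := by
      refine lt_top_iff_ne_top.2 fun htop => hg (Subtype.ext (LinearEquiv.ext fun w => ?_))
      simpa [fixedSpace, sub_eq_zero] using htop.symm.le (Submodule.mem_top (x := w))
    obtain ⟨x, hx⟩ := Submodule.exists_le_ker_of_lt_top _ hlt
    exact ⟨x, fun _ => hx⟩
  choose x hx using exists_covector
  have coord_ne_zero {x : Module.Dual ℂ V} (hx : x ≠ 0) : coord x ≠ 0 := by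
    contrapose! hx
    ext b
    simpa using congrArg (polyEval b) hx
  have hne : f * ∏ g ∈ Finset.univ.erase (1 : G), coord (x g) ≠ 0 :=
    mul_ne_zero hf (Finset.prod_ne_zero_iff.2 fun g hg =>
      coord_ne_zero (hx g (Finset.ne_of_mem_erase hg)).1)
  obtain ⟨b, hb⟩ : ∃ b, polyEval b (f * ∏ g ∈ Finset.univ.erase (1 : G), coord (x g)) ≠ 0 := by
    by_contra! h
    exact hne (eq_zero_of_polyEval h)
  simp only [map_mul, map_prod, polyEval_coord] at hb
  refine ⟨b, left_ne_zero_of_mul hb, fun g hg => ?_⟩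
  by_contra hg1
  refine Finset.prod_ne_zero_iff.1 (right_ne_zero_of_mul hb) g (by simp [hg1]) ((hx g hg1).2 ?_)
  simp [fixedSpace, hg]

theorem exists_invariant_polyEval_pderiv {G : Subgroup (V ≃ₗ[ℂ] V)} [Finite G] {b : V}
    (hb : ∀ g : G, (g : V ≃ₗ[ℂ] V) b = b → g = 1) (x : Module.Dual ℂ V) :
    ∃ p : Poly V, (∀ g : G, polyAct (g : V ≃ₗ[ℂ] V) p = p) ∧
      ∀ y, polyEval b (pderiv y p) = x y := by
  classical
  have := Fintype.ofFinite G
  obtain ⟨q, hq, hq'⟩ := exists_polyEval_eq_one_of_notMem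
    ((Finset.univ.image fun g : G => (g : V ≃ₗ[ℂ] V) b).erase b) (Finset.notMem_erase b _)
  -- `h` is tangent to `coord x` at `b` and vanishes doubly at the rest of the orbit of `b`.
  let h : Poly V := q * (q * (coord x - algebraMap ℂ (Poly V) (x b)))
  refine ⟨∑ g : G, polyAct (g : V ≃ₗ[ℂ] V) h, fun g => ?_, fun y => ?_⟩
  · simpa [polyAct_mul] using
      Equiv.sum_comp (Equiv.mulLeft g) fun k : G => polyAct (k : V ≃ₗ[ℂ] V) h
  · rw [map_sum, map_sum, Finset.sum_eq_single_of_mem 1 (Finset.mem_univ _)]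
    · simp [h, polyAct_one, pderiv_mul, pderiv_coord, hq]
    · intro g _ hg
      have hvanish : polyEval ((g : V ≃ₗ[ℂ] V)⁻¹ b) q = 0 := by
        refine hq' _ (Finset.mem_erase.2 ⟨fun hgb => hg ?_, Finset.mem_image.2 ⟨g⁻¹, by simp⟩⟩)
        exact inv_eq_one.1 (hb g⁻¹ (by simpa using hgb))
      have hy : y = (g : V ≃ₗ[ℂ] V) ((g : V ≃ₗ[ℂ] V)⁻¹ y) :=
        ((g : V ≃ₗ[ℂ] V).apply_symm_apply y).symm
      rw [hy, ← polyAct_pderiv, polyEval_polyAct]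
      simp only [h, pderiv_mul, map_add, map_mul, hvanish, zero_mul, mul_zero, add_zero]

end RegularPoints

section DunklOperators

variable {V : Type*} [AddCommGroup V] [Module ℂ V] {G : Subgroup (V ≃ₗ[ℂ] V)}

theorem form_eq_zero_iff (r : Refl G) (w : V) : form r w = 0 ↔ (r.1 : V ≃ₗ[ℂ] V) w = w := by
  rw [← LinearMap.mem_ker, ker_form, fixedSpace, LinearMap.mem_ker]
  simp [sub_eq_zero]

theorem exists_eq_form_smul {E : Type*} [AddCommGroup E] [Module ℂ E] (r : Refl G)
    (T : V →ₗ[ℂ] E) (hT : ∀ w, (r.1 : V ≃ₗ[ℂ] V) w = w → T w = 0) :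
    ∃ γ, ∀ y, T y = form r y • γ := by
  obtain ⟨y₀, h₀⟩ : ∃ y, form r y = 1 :=
    LinearMap.surjective (form_ne_zero r) 1
  refine ⟨T y₀, fun y => ?_⟩
  have h := hT (y - form r y • y₀) ((form_eq_zero_iff r _).1 (by simp [h₀]))
  rwa [map_sub, map_smul, sub_eq_zero] at h

theorem exists_coroot (r : Refl G) :
    ∃ γ : V, ∀ y, y - (r.1 : V ≃ₗ[ℂ] V)⁻¹ y = form r y • γ :=
  exists_eq_form_smul r (.id - ((r.1 : V ≃ₗ[ℂ] V)⁻¹ : V ≃ₗ[ℂ] V).toLinearMap) fun w hw => by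
    have hw' : (r.1 : V ≃ₗ[ℂ] V)⁻¹ w = w := (LinearEquiv.symm_apply_eq _).2 hw.symm
    simp only [LinearMap.sub_apply, LinearMap.id_apply, LinearEquiv.coe_coe, hw', sub_self]

/-- The vector `γ_r` dual to `α_r`, normalized by `y - r⁻¹ y = ⟨α_r, y⟩ γ_r` for `y ∈ V`. -/
def coroot (r : Refl G) : V := Classical.choose (exists_coroot r)

theorem form_smul_coroot (r : Refl G) (y : V) :
    form r y • coroot r = y - (r.1 : V ≃ₗ[ℂ] V)⁻¹ y :=
  (Classical.choose_spec (exists_coroot r) y).symm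

theorem divDiff_mul (r : Refl G) (f h : Poly V) :
    divDiff r (f * h) = divDiff r f * polyAct (r.1 : V ≃ₗ[ℂ] V) h + f * divDiff r h := by
  apply mul_left_cancel₀ (coord_form_ne_zero r)
  have hf := form_mul_divDiff r f
  have hh := form_mul_divDiff r h
  rw [form_mul_divDiff, map_mul]
  linear_combination (-polyAct (r.1 : V ≃ₗ[ℂ] V) h) * hf - f * hh

theorem divDiff_coord (r : Refl G) (x : Module.Dual ℂ V) :
    divDiff r (coord x) = algebraMap ℂ (Poly V) (x (coroot r)) := by
  apply mul_left_cancel₀ (coord_form_ne_zero r)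
  rw [form_mul_divDiff, polyAct_coord, mul_comm, ← Algebra.smul_def, ← map_smul, ← map_sub]
  congr 1
  ext y
  rw [LinearMap.smul_apply, smul_eq_mul, mul_comm, ← smul_eq_mul, ← map_smul, form_smul_coroot,
    map_sub]
  rfl

theorem divDiff_eq_zero {r : Refl G} {f : Poly V} (hf : polyAct (r.1 : V ≃ₗ[ℂ] V) f = f) :
    divDiff r f = 0 := by
  apply mul_left_cancel₀ (coord_form_ne_zero r)
  rw [form_mul_divDiff, hf, sub_self, mul_zero]

theorem divDiff_mem_homog (r : Refl G) {d : ℕ} {f : Poly V} (hf : f ∈ homog V (d + 1)) :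
    divDiff r f ∈ homog V d :=
  homog_succ_le_comap (τ := (polyAct (r.1 : V ≃ₗ[ℂ] V)).toLinearMap)
    (fun _ _ h => polyAct_mem_homog _ h) (divDiff_mul r)
    (fun x => mem_homog_zero.2 ⟨_, (divDiff_coord r x).symm⟩) d hf

/-- Conjugation by `g`, as a permutation of the reflections. -/
def reflConj (g : G) : Refl G ≃ Refl G where
  toFun r := ⟨g * r.1 * g⁻¹, isReflection_conj g r.1 r.2⟩
  invFun r := ⟨g⁻¹ * r.1 * g, by simpa using isReflection_conj g⁻¹ r.1 r.2⟩
  left_inv r := Subtype.ext (by simp [mul_assoc])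
  right_inv r := Subtype.ext (by simp [mul_assoc])

/-- The scalar `t` records that `α_{g r g⁻¹}` is only proportional to `g α_r`. -/
theorem exists_form_reflConj (g : G) (r : Refl G) :
    ∃ t : ℂ, ∀ y, form (reflConj g r) ((g : V ≃ₗ[ℂ] V) y) = form r y * t :=
  exists_eq_form_smul r (form (reflConj g r) ∘ₗ (g : V ≃ₗ[ℂ] V).toLinearMap) fun w hw => by
    rw [LinearMap.comp_apply, form_eq_zero_iff]
    simp [reflConj, hw]

theorem polyAct_divDiff (g : G) (r : Refl G) (y : V) (f : Poly V) :
    form r y • polyAct (g : V ≃ₗ[ℂ] V) (divDiff r f) =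
      form (reflConj g r) ((g : V ≃ₗ[ℂ] V) y) •
        divDiff (reflConj g r) (polyAct (g : V ≃ₗ[ℂ] V) f) := by
  obtain ⟨t, ht⟩ := exists_form_reflConj g r
  have hform : coord (form (reflConj g r)) = t • polyAct (g : V ≃ₗ[ℂ] V) (coord (form r)) := by
    rw [polyAct_coord, ← map_smul]
    congr 1
    ext w
    have hgw : (g : V ≃ₗ[ℂ] V) ((g : V ≃ₗ[ℂ] V)⁻¹ w) = w :=
      (g : V ≃ₗ[ℂ] V).apply_symm_apply w
    simpa [hgw, mul_comm] using ht ((g : V ≃ₗ[ℂ] V)⁻¹ w)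
  have hconj : (((reflConj g r).1 : G) : V ≃ₗ[ℂ] V) * (g : V ≃ₗ[ℂ] V) =
      (g : V ≃ₗ[ℂ] V) * (r.1 : V ≃ₗ[ℂ] V) := by
    simp [reflConj]
  apply mul_left_cancel₀ (coord_form_ne_zero (reflConj g r))
  rw [mul_smul_comm, mul_smul_comm, form_mul_divDiff, hform, smul_mul_assoc, ← map_mul,
    form_mul_divDiff, ← AlgHom.comp_apply, ← polyAct_mul, hconj, ht, polyAct_mul,
    AlgHom.comp_apply, map_sub, smul_smul]

variable [Finite G] (c : Param G)

theorem dunkl_apply (y : V) (f : Poly V) :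
    dunkl c y f = pderiv y f - ∑ r : Refl G, (c.val r * form r y) • divDiff r f := by
  simp [dunkl]

theorem dunkl_add (y z : V) : dunkl c (y + z) = dunkl c y + dunkl c z := by
  ext f
  simp only [dunkl_apply, pderiv_add, map_add, mul_add, add_smul, Finset.sum_add_distrib,
    LinearMap.add_apply]
  abel

theorem dunkl_smul (t : ℂ) (y : V) : dunkl c (t • y) = t • dunkl c y := by
  ext f
  simp only [dunkl_apply, pderiv_smul, map_smul, LinearMap.smul_apply, smul_sub, Finset.smul_sum,
    smul_smul, smul_eq_mul, mul_left_comm]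

theorem dunkl_one (y : V) : dunkl c y 1 = 0 := by
  have hdivDiff (r : Refl G) : divDiff r (1 : Poly V) = 0 := divDiff_eq_zero (map_one _)
  have hpderiv : pderiv y (1 : Poly V) = 0 := by simpa using pderiv_algebraMap y 1
  simp [dunkl_apply, hdivDiff, hpderiv]

theorem dunkl_mul (y : V) (f h : Poly V) :
    dunkl c y (f * h) = f * dunkl c y h + (pderiv y f * h -
      ∑ r : Refl G, (c.val r * form r y) • (divDiff r f * polyAct (r.1 : V ≃ₗ[ℂ] V) h)) := by
  simp only [dunkl_apply, pderiv_mul, divDiff_mul, smul_add, Finset.sum_add_distrib, mul_sub,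
    Finset.mul_sum, mul_smul_comm]
  ring

theorem polyAct_dunkl (g : G) (y : V) (f : Poly V) :
    polyAct (g : V ≃ₗ[ℂ] V) (dunkl c y f) =
      dunkl c ((g : V ≃ₗ[ℂ] V) y) (polyAct (g : V ≃ₗ[ℂ] V) f) := by
  rw [dunkl_apply, dunkl_apply, map_sub, polyAct_pderiv, map_sum]
  congr 1
  refine (Finset.sum_congr rfl fun r _ => ?_).trans ((reflConj g).sum_comp fun r =>
    (c.val r * form r ((g : V ≃ₗ[ℂ] V) y)) • divDiff r (polyAct (g : V ≃ₗ[ℂ] V) f))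
  rw [c.conj g r (reflConj g r) rfl, map_smul, mul_smul, mul_smul, polyAct_divDiff]

end DunklOperators

section Relations

variable {V : Type*} [AddCommGroup V] [Module ℂ V] {G : Subgroup (V ≃ₗ[ℂ] V)} [Finite G]
  (c : Param G)

/-- The defining action of `H_c(G, V)` on `ℂ[V]`. -/
def toEnd : RCA c →ₐ[ℂ] Module.End ℂ (Poly V) := (rca c).val

theorem toEnd_injective : Function.Injective (toEnd c) := Subtype.val_injective

/-- The inclusion of `ℂ[V]` into `H_c(G, V)` as multiplication operators. -/
def mulElt : Poly V →ₐ[ℂ] RCA c :=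
  (Algebra.lmul ℂ (Poly V)).codRestrict (rca c)
    fun f => Algebra.subset_adjoin (Or.inl (Or.inl ⟨f, rfl⟩))

@[simp]
theorem toEnd_mulElt (f h : Poly V) : toEnd c (mulElt c f) h = f * h := rfl

@[simp]
theorem toEnd_groupElt (g : G) (h : Poly V) :
    toEnd c (groupElt c g) h = polyAct (g : V ≃ₗ[ℂ] V) h := rfl

@[simp]
theorem toEnd_dunklElt (y : V) : toEnd c (dunklElt c y) = dunkl c y := rfl

theorem groupElt_mul (g h : G) : groupElt c (g * h) = groupElt c g * groupElt c h :=
  toEnd_injective c (LinearMap.ext fun f => by simp [polyAct_mul])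

theorem groupElt_one : groupElt c 1 = 1 :=
  toEnd_injective c (LinearMap.ext fun f => by simp [polyAct_one])

theorem dunklElt_add (y z : V) : dunklElt c (y + z) = dunklElt c y + dunklElt c z :=
  Subtype.ext (dunkl_add c y z)

theorem dunklElt_smul (t : ℂ) (y : V) : dunklElt c (t • y) = t • dunklElt c y :=
  Subtype.ext (dunkl_smul c t y)

/-- The Dunkl operators, as a linear map from `V` to `H_c(G, V)`. -/
def dunklHom : V →ₗ[ℂ] RCA c where
  toFun := dunklElt c
  map_add' := dunklElt_add c
  map_smul' := dunklElt_smul c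

theorem groupElt_mul_mulElt (g : G) (f : Poly V) :
    groupElt c g * mulElt c f = mulElt c (polyAct (g : V ≃ₗ[ℂ] V) f) * groupElt c g :=
  toEnd_injective c (LinearMap.ext fun h => by simp)

theorem dunklElt_mul_groupElt (y : V) (g : G) :
    dunklElt c y * groupElt c g = groupElt c g * dunklElt c ((g : V ≃ₗ[ℂ] V)⁻¹ y) := by
  refine toEnd_injective c (LinearMap.ext fun h => ?_)
  have hgy : (g : V ≃ₗ[ℂ] V) ((g : V ≃ₗ[ℂ] V)⁻¹ y) = y := (g : V ≃ₗ[ℂ] V).apply_symm_apply y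
  simp only [map_mul, Module.End.mul_apply, toEnd_groupElt, toEnd_dunklElt, polyAct_dunkl, hgy]

theorem dunklElt_mul_mulElt (y : V) (f : Poly V) :
    dunklElt c y * mulElt c f = mulElt c f * dunklElt c y + (mulElt c (pderiv y f) -
      ∑ r : Refl G, (c.val r * form r y) • (mulElt c (divDiff r f) * groupElt c r.1)) :=
  toEnd_injective c (LinearMap.ext fun h => by simp [dunkl_mul, LinearMap.sum_apply])

section Commutators

attribute [local instance] LieRing.ofAssociativeRing

theorem lie_dunklElt_coord (y : V) (x : Module.Dual ℂ V) :
    ⁅dunklElt c y, mulElt c (coord x)⁆ = algebraMap ℂ (RCA c) (x y) -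
      ∑ r : Refl G, (c.val r * form r y * x (coroot r)) • groupElt c r.1 := by
  simp only [Ring.lie_def, dunklElt_mul_mulElt, add_sub_cancel_left, pderiv_coord, divDiff_coord,
    AlgHom.commutes, ← Algebra.smul_def, smul_smul]

theorem lie_dunklElt_refl (y : V) (r : Refl G) :
    ⁅dunklElt c y, groupElt c r.1⁆ = -(form r y • (groupElt c r.1 * dunklElt c (coroot r))) := by
  have hsub : dunklElt c (y - (r.1 : V ≃ₗ[ℂ] V)⁻¹ y) =
      dunklElt c y - dunklElt c ((r.1 : V ≃ₗ[ℂ] V)⁻¹ y) := map_sub (dunklHom c) _ _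
  rw [Ring.lie_def, dunklElt_mul_groupElt, ← mul_smul_comm, ← dunklElt_smul, form_smul_coroot,
    hsub, mul_sub, neg_sub]

theorem lie_lie_dunklElt_coord (y z : V) (x : Module.Dual ℂ V) :
    ⁅⁅dunklElt c y, dunklElt c z⁆, mulElt c (coord x)⁆ = 0 := by
  have lie_lie_coord (y z : V) : ⁅dunklElt c y, ⁅dunklElt c z, mulElt c (coord x)⁆⁆ =
      ∑ r : Refl G, (c.val r * form r z * x (coroot r) * form r y) •
        (groupElt c r.1 * dunklElt c (coroot r)) := by
    have hscalar : ⁅dunklElt c y, algebraMap ℂ (RCA c) (x z)⁆ = 0 := by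
      rw [Ring.lie_def, Algebra.commutes, sub_self]
    rw [lie_dunklElt_coord, lie_sub, hscalar, lie_sum, zero_sub, ← Finset.sum_neg_distrib]
    refine Finset.sum_congr rfl fun r _ => ?_
    rw [lie_smul, lie_dunklElt_refl, smul_neg, neg_neg, smul_smul]
  rw [lie_lie, lie_lie_coord, lie_lie_coord, sub_eq_zero]
  refine Finset.sum_congr rfl fun r _ => ?_
  congr 1
  ring

/-- The commutator of two Dunkl operators commutes with `ℂ[V]` by the Jacobi identity, so it is
multiplication by its value at `1`, which is `0`. -/
theorem commute_dunklElt (y z : V) : Commute (dunklElt c y) (dunklElt c z) := by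
  have commute_mulElt (f : Poly V) : Commute ⁅dunklElt c y, dunklElt c z⁆ (mulElt c f) := by
    induction f using poly_induction with
    | algebraMap a => simpa only [AlgHom.commutes] using Algebra.commute_algebraMap_right a _
    | coord x => exact sub_eq_zero.1 (lie_lie_dunklElt_coord c y z x)
    | mul a b ha hb => simpa only [map_mul] using ha.mul_right hb
    | add a b ha hb => simpa only [map_add] using ha.add_right hb
  have kills_one : toEnd c ⁅dunklElt c y, dunklElt c z⁆ 1 = 0 := by
    simp [Ring.lie_def, dunkl_one]
  refine commute_iff_lie_eq.2 (toEnd_injective c (LinearMap.ext fun f => ?_))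
  have h := congrArg (fun T => toEnd c T 1) (commute_mulElt f).eq
  simpa only [map_mul, Module.End.mul_apply, toEnd_mulElt, mul_one, kills_one,
    mul_zero, map_zero, LinearMap.zero_apply] using h

end Commutators

theorem adjoin_generators : Algebra.adjoin ℂ (Set.range (mulElt c) ∪ Set.range (groupElt c) ∪
    Set.range (dunklElt c)) = ⊤ := by
  refine top_unique ((Algebra.adjoin_adjoin_coe_preimage (R := ℂ)).ge.trans
    (Algebra.adjoin_mono ?_))
  rintro T ((⟨f, hf⟩ | ⟨g, hg⟩) | ⟨y, hy⟩)
  · exact Or.inl (Or.inl ⟨f, Subtype.ext hf⟩)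
  · exact Or.inl (Or.inr ⟨g, Subtype.ext hg⟩)
  · exact Or.inr ⟨y, Subtype.ext hy⟩

theorem smul_mem_of_generators {M : Type*} [AddCommGroup M] [Module (RCA c) M]
    (U : AddSubmonoid M) (hmul : ∀ f, ∀ m ∈ U, mulElt c f • m ∈ U)
    (hgroup : ∀ g, ∀ m ∈ U, groupElt c g • m ∈ U) (hdunkl : ∀ y, ∀ m ∈ U, dunklElt c y • m ∈ U)
    (T : RCA c) : ∀ m ∈ U, T • m ∈ U := by
  have hT : T ∈ Algebra.adjoin ℂ (Set.range (mulElt c) ∪ Set.range (groupElt c) ∪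
      Set.range (dunklElt c)) := adjoin_generators c ▸ Algebra.mem_top
  induction hT using Algebra.adjoin_induction with
  | mem T hT =>
    obtain (⟨f, rfl⟩ | ⟨g, rfl⟩) | ⟨y, rfl⟩ := hT
    exacts [hmul f, hgroup g, hdunkl y]
  | algebraMap z => simpa only [AlgHom.commutes] using hmul (algebraMap ℂ (Poly V) z)
  | add S T _ _ ihS ihT => exact fun m hm => (add_smul S T m).symm ▸ add_mem (ihS m hm) (ihT m hm)
  | mul S T _ _ ihS ihT => exact fun m hm => (mul_smul S T m).symm ▸ ihS _ (ihT m hm)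

end Relations

section PBW

variable {V : Type*} [AddCommGroup V] [Module ℂ V] {G : Subgroup (V ≃ₗ[ℂ] V)} [Finite G]
  (c : Param G)

instance : Module (Poly V) (RCA c) := Module.compHom (RCA c) (mulElt c).toRingHom

theorem poly_smul_eq (f : Poly V) (T : RCA c) : f • T = mulElt c f * T := rfl

instance : IsScalarTower (Poly V) (RCA c) (RCA c) := ⟨fun f S T => mul_assoc (mulElt c f) S T⟩

instance : IsScalarTower ℂ (Poly V) (RCA c) :=
  ⟨fun z f T => by simp only [poly_smul_eq, map_smul, smul_mul_assoc]⟩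

theorem groupElt_mul_smul (g : G) (f : Poly V) (T : RCA c) :
    groupElt c g * f • T = polyAct (g : V ≃ₗ[ℂ] V) f • (groupElt c g * T) := by
  simp only [poly_smul_eq, ← mul_assoc, groupElt_mul_mulElt]

/-- The operator `T ↦ T p - p T` on `H_c(G, V)`. -/
def commutator (p : Poly V) : RCA c →ₗ[Poly V] RCA c where
  toFun T := T * mulElt c p - p • T
  map_add' S T := by rw [add_mul, smul_add, add_sub_add_comm]
  map_smul' f T := by rw [RingHom.id_apply, smul_mul_assoc, smul_sub, smul_comm f p]

theorem commutator_apply (p : Poly V) (T : RCA c) : commutator c p T = T * mulElt c p - p • T :=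
  rfl

section Invariant

variable {c} {p : Poly V} (hp : ∀ g : G, polyAct (g : V ≃ₗ[ℂ] V) p = p)
include hp

theorem commutator_groupElt_mul (g : G) (T : RCA c) :
    commutator c p (groupElt c g * T) = groupElt c g * commutator c p T := by
  rw [commutator_apply, commutator_apply, mul_sub, groupElt_mul_smul, hp, mul_assoc]

theorem commutator_dunklElt_mul (y : V) (T : RCA c) :
    commutator c p (dunklElt c y * T) = dunklElt c y * commutator c p T + pderiv y p • T := by
  have hcomm : dunklElt c y * mulElt c p = mulElt c p * dunklElt c y + mulElt c (pderiv y p) := by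
    rw [dunklElt_mul_mulElt]
    simp [divDiff_eq_zero (hp _)]
  simp only [commutator_apply, poly_smul_eq, mul_sub, ← mul_assoc, hcomm, add_mul]
  abel

theorem commutator_pow_groupElt_mul (g : G) (T : RCA c) (n : ℕ) :
    (commutator c p ^ n) (groupElt c g * T) = groupElt c g * (commutator c p ^ n) T := by
  induction n with
  | zero => rfl
  | succ n ih => rw [pow_succ', Module.End.mul_apply, ih, commutator_groupElt_mul hp,
      Module.End.mul_apply]

theorem commutator_pow_dunklElt_mul (y : V) (T : RCA c) (n : ℕ) :
    (commutator c p ^ (n + 1)) (dunklElt c y * T) =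
      dunklElt c y * (commutator c p ^ (n + 1)) T +
        (n + 1) • pderiv y p • (commutator c p ^ n) T := by
  induction n with
  | zero => simp [commutator_dunklElt_mul hp]
  | succ n ih =>
    rw [pow_succ', Module.End.mul_apply, ih, map_add, commutator_dunklElt_mul hp, map_nsmul,
      map_smul, ← Module.End.mul_apply, ← Module.End.mul_apply, ← pow_succ', ← pow_succ',
      add_assoc, ← succ_nsmul' _ (n + 1)]

end Invariant

variable {ι : Type*} (y : ι → V)

/-- The monomial in the pairwise commuting Dunkl operators of the vectors `y i`, `i ∈ s`. -/
def dunklMon (s : Multiset ι) : RCA c :=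
  (s.map fun i => dunklElt c (y i)).noncommProd fun S hS T hT _ => by
    obtain ⟨i, _, rfl⟩ := Multiset.mem_map.1 hS
    obtain ⟨j, _, rfl⟩ := Multiset.mem_map.1 hT
    exact commute_dunklElt c _ _

@[simp]
theorem dunklMon_zero : dunklMon c y 0 = 1 := by
  simp [dunklMon]

theorem dunklMon_cons (i : ι) (s : Multiset ι) :
    dunklMon c y (i ::ₘ s) = dunklElt c (y i) * dunklMon c y s := by
  simp [dunklMon]

theorem dunklMon_cons' (i : ι) (s : Multiset ι) :
    dunklMon c y (i ::ₘ s) = dunklMon c y s * dunklElt c (y i) := by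
  simp only [dunklMon, Multiset.map_cons, Multiset.noncommProd_cons']

theorem commutator_pow_dunklMon_eq_zero {p : Poly V}
    (hp : ∀ g : G, polyAct (g : V ≃ₗ[ℂ] V) p = p) (s : Multiset ι) {n : ℕ} (hn : s.card < n) :
    (commutator c p ^ n) (dunklMon c y s) = 0 := by
  induction s using Multiset.induction_on generalizing n with
  | empty =>
    obtain ⟨n, rfl⟩ := Nat.exists_eq_succ_of_ne_zero hn.ne'
    have hone : commutator c p 1 = 0 := by simp [commutator_apply, poly_smul_eq]
    rw [dunklMon_zero, pow_succ, Module.End.mul_apply, hone, map_zero]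
  | cons i s ih =>
    rw [Multiset.card_cons] at hn
    obtain ⟨n, rfl⟩ := Nat.exists_eq_succ_of_ne_zero (Nat.ne_zero_of_lt hn)
    rw [dunklMon_cons, commutator_pow_dunklElt_mul hp, ih (by omega), ih (by omega), mul_zero,
      smul_zero, smul_zero, zero_add]

theorem commutator_pow_card_dunklMon {p : Poly V}
    (hp : ∀ g : G, polyAct (g : V ≃ₗ[ℂ] V) p = p) (s : Multiset ι) :
    (commutator c p ^ s.card) (dunklMon c y s) =
      s.card.factorial • (s.map fun i => pderiv (y i) p).prod • 1 := by
  induction s using Multiset.induction_on with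
  | empty => simp
  | cons i s ih =>
    rw [Multiset.card_cons, dunklMon_cons, commutator_pow_dunklElt_mul hp,
      commutator_pow_dunklMon_eq_zero c y hp s (Nat.lt_succ_self _), mul_zero, zero_add, ih,
      Multiset.map_cons, Multiset.prod_cons, Nat.factorial_succ, mul_smul, mul_smul,
      smul_comm (pderiv (y i) p) s.card.factorial]

theorem linearIndependent_groupElt : LinearIndependent (Poly V) (groupElt c) := by
  have hinj : Function.Injective fun g : G =>
      ((polyAct (g : V ≃ₗ[ℂ] V) : Poly V →ₐ[ℂ] Poly V) : Poly V →* Poly V) := fun g h hgh =>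
    Subtype.ext (polyAct_injective (AlgHom.ext fun f => DFunLike.congr_fun hgh f))
  have hdedekind := (linearIndependent_monoidHom (Poly V) (Poly V)).comp _ hinj
  rw [linearIndependent_iff'] at hdedekind ⊢
  refine fun s a ha => hdedekind s a (funext fun f => ?_)
  have haf := congrArg (fun T => toEnd c T f) ha
  simpa [poly_smul_eq, LinearMap.sum_apply] using haf

theorem linearIndependent_multiset_prod {K : Type*} [CommRing K] [IsDomain K] [CharZero K] :
    LinearIndependent K fun (s : Multiset ι) (t : ι → K) => (s.map t).prod := by
  classical
  let character (s : Multiset ι) : (ι → K) →* K :=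
    { toFun := fun t => (s.map t).prod
      map_one' := by simp
      map_mul' := fun t u => by simp }
  have hinj : Function.Injective character := fun s s' h => by
    ext i
    have hi := DFunLike.congr_fun h (Pi.mulSingle i 2)
    have eval_mulSingle (s : Multiset ι) : character s (Pi.mulSingle i 2) = 2 ^ s.count i := by
      simp only [character, MonoidHom.coe_mk, OneHom.coe_mk]
      rw [Multiset.prod_map_eq_pow_single i fun j hj _ => Pi.mulSingle_eq_of_ne hj 2,
        Pi.mulSingle_eq_same]
    rw [eval_mulSingle, eval_mulSingle] at hi
    exact Nat.pow_right_injective le_rfl (by exact_mod_cast hi)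
  exact (linearIndependent_monoidHom (ι → K) K).comp character hinj

/-- The elements `g y^s` of `H_c(G, V)`. -/
def pbw (q : G × Multiset ι) : RCA c := groupElt c q.1 * dunklMon c y q.2

theorem commutator_pow_pbw {p : Poly V} (hp : ∀ g : G, polyAct (g : V ≃ₗ[ℂ] V) p = p) {n : ℕ}
    {q : G × Multiset ι} (hq : q.2.card ≤ n) :
    (commutator c p ^ n) (pbw c y q) =
      (if q.2.card = n then n.factorial •
        polyAct (q.1 : V ≃ₗ[ℂ] V) (q.2.map fun i => pderiv (y i) p).prod else 0) •
          groupElt c q.1 := by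
  rw [pbw, commutator_pow_groupElt_mul hp]
  split_ifs with hn
  · rw [← hn, commutator_pow_card_dunklMon c y hp, mul_smul_comm, groupElt_mul_smul, mul_one,
      smul_assoc]
  · rw [commutator_pow_dunklMon_eq_zero c y hp _ (hq.lt_of_ne hn), mul_zero, zero_smul]

theorem sum_symbol_eq_zero {l : G × Multiset ι → Poly V} {T : Finset G} {S : Finset (Multiset ι)}
    (hl : ∑ q ∈ T ×ˢ S, l q • pbw c y q = 0) {n : ℕ} (hn : ∀ s ∈ S, s.card ≤ n) {p : Poly V}
    (hp : ∀ g : G, polyAct (g : V ≃ₗ[ℂ] V) p = p) {g : G} (hg : g ∈ T) :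
    ∑ s ∈ S with s.card = n,
      l (g, s) * polyAct (g : V ≃ₗ[ℂ] V) (s.map fun i => pderiv (y i) p).prod = 0 := by
  have relation : ∑ g ∈ T, (∑ s ∈ S with s.card = n, n.factorial •
      (l (g, s) * polyAct (g : V ≃ₗ[ℂ] V) (s.map fun i => pderiv (y i) p).prod)) •
        groupElt c g = 0 := by
    have h := congrArg (commutator c p ^ n) hl
    rw [Finset.sum_product, map_sum, map_zero] at h
    rw [← h]
    refine Finset.sum_congr rfl fun g _ => ?_
    rw [map_sum, Finset.sum_smul, Finset.sum_filter]
    refine Finset.sum_congr rfl fun s hs => ?_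
    rw [map_smul, commutator_pow_pbw c y hp (hn s hs), ← smul_assoc]
    split_ifs
    · rw [smul_eq_mul, mul_smul_comm]
    · rw [smul_zero, zero_smul]
  have h := linearIndependent_iff'.1 (linearIndependent_groupElt c) T _ relation g hg
  rw [← Finset.smul_sum, ← Nat.cast_smul_eq_nsmul ℂ] at h
  exact (smul_eq_zero.1 h).resolve_left (Nat.cast_ne_zero.2 n.factorial_ne_zero)

variable (b : Module.Basis ι ℂ V)

theorem linearIndependent_pbw [FiniteDimensional ℂ V] :
    LinearIndependent (Poly V) (pbw c b) := by
  classical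
  refine linearIndependent_iff.2 fun l hl => ?_
  by_contra hne
  obtain ⟨⟨g, s₀⟩, hmem, hmax⟩ :=
    l.support.exists_max_image (fun q => q.2.card) (Finsupp.support_nonempty_iff.2 hne)
  obtain ⟨v, hv, hreg⟩ := exists_polyEval_ne_zero_of_stabilizer_eq_one G
    (Finsupp.mem_support_iff.1 hmem)
  have hreg' (h : G) (hh : (h : V ≃ₗ[ℂ] V) ((g : V ≃ₗ[ℂ] V)⁻¹ v) = (g : V ≃ₗ[ℂ] V)⁻¹ v) :
      h = 1 := by
    refine conj_eq_one_iff.1 (hreg (g * h * g⁻¹) ?_)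
    change (g : V ≃ₗ[ℂ] V) ((h : V ≃ₗ[ℂ] V) ((g : V ≃ₗ[ℂ] V)⁻¹ v)) = v
    rw [hh]
    exact (g : V ≃ₗ[ℂ] V).apply_symm_apply v
  have hsum : ∑ q ∈ l.support.image Prod.fst ×ˢ l.support.image Prod.snd, l q • pbw c b q = 0 :=
    (l.sum_of_support_subset Finset.subset_product (fun q f => f • pbw c b q)
      fun _ _ => zero_smul _ _).symm.trans hl
  have relation (t : ι → ℂ) : ∑ s ∈ l.support.image Prod.snd with s.card = s₀.card,
      polyEval v (l (g, s)) * (s.map t).prod = 0 := by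
    obtain ⟨p, hp, hpx⟩ := exists_invariant_polyEval_pderiv hreg' (b.constr ℂ t)
    have h := congrArg (polyEval v) (sum_symbol_eq_zero c b hsum (n := s₀.card)
      (by simpa using fun s g hs => hmax (g, s) hs) hp (Finset.mem_image_of_mem _ hmem))
    simpa only [map_sum, map_mul, polyEval_polyAct, map_multiset_prod, Multiset.map_map,
      Function.comp_def, hpx, Module.Basis.constr_basis, map_zero] using h
  refine hv (linearIndependent_iff'.1 (linearIndependent_multiset_prod (K := ℂ))
    {s ∈ l.support.image Prod.snd | s.card = s₀.card} (fun s => polyEval v (l (g, s)))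
    (funext fun t => ?_) s₀ ?_)
  · simpa using relation t
  · exact Finset.mem_filter.2 ⟨Finset.mem_image_of_mem _ hmem, rfl⟩

theorem dunklElt_mul_pbw_mem [Finite ι] (y : V) (q : G × Multiset ι) :
    dunklElt c y * pbw c b q ∈ Submodule.span (Poly V) (Set.range (pbw c b)) := by
  have := Fintype.ofFinite ι
  have expand : dunklElt c ((q.1 : V ≃ₗ[ℂ] V)⁻¹ y) =
      ∑ i, b.repr ((q.1 : V ≃ₗ[ℂ] V)⁻¹ y) i • dunklElt c (b i) := by
    conv_lhs => rw [← b.sum_repr ((q.1 : V ≃ₗ[ℂ] V)⁻¹ y)]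
    exact (map_sum (dunklHom c) _ _).trans
      (Finset.sum_congr rfl fun i _ => map_smul (dunklHom c) _ _)
  rw [pbw, ← mul_assoc, dunklElt_mul_groupElt, mul_assoc, expand, Finset.sum_mul, Finset.mul_sum]
  refine sum_mem fun i _ => ?_
  rw [smul_mul_assoc, mul_smul_comm, ← dunklMon_cons, ← algebraMap_smul (Poly V)]
  exact Submodule.smul_mem _ _ (Submodule.subset_span ⟨(q.1, i ::ₘ q.2), rfl⟩)

theorem span_pbw [Finite ι] : Submodule.span (Poly V) (Set.range (pbw c b)) = ⊤ := by
  let U := Submodule.span (Poly V) (Set.range (pbw c b))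
  have hmul (f : Poly V) (T : RCA c) (hT : T ∈ U) : mulElt c f • T ∈ U := U.smul_mem f hT
  have hgroup (g : G) (T : RCA c) (hT : T ∈ U) : groupElt c g * T ∈ U := by
    induction hT using Submodule.span_induction with
    | mem T hT =>
      obtain ⟨q, rfl⟩ := hT
      refine Submodule.subset_span ⟨(g * q.1, q.2), ?_⟩
      rw [pbw, pbw, groupElt_mul, mul_assoc]
    | zero => exact (mul_zero (groupElt c g)).symm ▸ U.zero_mem
    | add S T _ _ hS hT => exact (mul_add (groupElt c g) S T).symm ▸ U.add_mem hS hT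
    | smul f T _ hT =>
      rw [groupElt_mul_smul]
      exact U.smul_mem _ hT
  have hdunkl (y : V) (T : RCA c) (hT : T ∈ U) : dunklElt c y * T ∈ U := by
    induction hT using Submodule.span_induction with
    | mem T hT =>
      obtain ⟨q, rfl⟩ := hT
      exact dunklElt_mul_pbw_mem c b y q
    | zero => exact (mul_zero (dunklElt c y)).symm ▸ U.zero_mem
    | add S T _ _ hS hT => exact (mul_add (dunklElt c y) S T).symm ▸ U.add_mem hS hT
    | smul f T hT ih =>
      rw [poly_smul_eq, ← mul_assoc, dunklElt_mul_mulElt, add_mul, sub_mul,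
        Finset.sum_mul, mul_assoc]
      refine add_mem (hmul f _ ih) (sub_mem (hmul _ T hT) (sum_mem fun r _ => ?_))
      rw [smul_mul_assoc, mul_assoc, ← algebraMap_smul (Poly V)]
      exact U.smul_mem _ (hmul _ _ (hgroup r.1 T hT))
  have hone : (1 : RCA c) ∈ U := Submodule.subset_span ⟨(1, 0), by simp [pbw, groupElt_one]⟩
  refine (Submodule.eq_top_iff' (p := U)).2 fun T => ?_
  simpa using smul_mem_of_generators c U.toAddSubmonoid hmul hgroup hdunkl T 1 hone

/-- The Poincaré–Birkhoff–Witt basis of `H_c(G, V)` over `ℂ[V]`. -/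
def pbwBasis [FiniteDimensional ℂ V] : Module.Basis (G × Multiset ι) (Poly V) (RCA c) :=
  have := Module.Finite.finite_basis b
  .mk (linearIndependent_pbw c b) (span_pbw c b).ge

end PBW

section Standard

variable {V : Type*} [AddCommGroup V] [Module ℂ V] {G : Subgroup (V ≃ₗ[ℂ] V)} [Finite G]
  (c : Param G)

theorem mulElt_smul {M : Type*} [AddCommGroup M] [Module (RCA c) M] [Module (Poly V) M]
    [IsScalarTower (Poly V) (RCA c) M] (f : Poly V) (m : M) : mulElt c f • m = f • m := by
  rw [← one_smul (RCA c) (f • m), ← smul_one_smul (RCA c) f, poly_smul_eq, mul_one, one_smul]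

variable {W : Type*} [AddCommGroup W] [Module ℂ W] (ρ : Representation ℂ G W)

/-- The canonical map `u ↦ 1 ⊗ u` from `W` to the induced module `Δ_c(W)`. -/
def gen : W →ₗ[ℂ] Standard c ρ :=
  (standardRel c ρ).mkQ.restrictScalars ℂ ∘ₗ TensorProduct.mk ℂ (RCA c) W 1

theorem smul_gen (T : RCA c) (u : W) :
    T • gen c ρ u = (standardRel c ρ).mkQ (T ⊗ₜ[ℂ] u) := by
  rw [gen, LinearMap.comp_apply, LinearMap.restrictScalars_apply, ← map_smul,
    TensorProduct.mk_apply, TensorProduct.smul_tmul', smul_eq_mul, mul_one]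

theorem groupElt_smul_gen (g : G) (u : W) : groupElt c g • gen c ρ u = gen c ρ (ρ g u) := by
  rw [← one_smul (RCA c) (gen c ρ (ρ g u)), smul_gen, smul_gen, ← sub_eq_zero, ← map_sub]
  exact (Submodule.Quotient.mk_eq_zero _).2 (Submodule.subset_span (Or.inl ⟨g, u, rfl⟩))

theorem dunklElt_smul_gen (y : V) (u : W) : dunklElt c y • gen c ρ u = 0 := by
  rw [smul_gen]
  exact (Submodule.Quotient.mk_eq_zero _).2 (Submodule.subset_span (Or.inr ⟨y, u, rfl⟩))

theorem groupElt_smul_smul_gen (g : G) (f : Poly V) (u : W) :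
    groupElt c g • f • gen c ρ u = polyAct (g : V ≃ₗ[ℂ] V) f • gen c ρ (ρ g u) := by
  rw [← mulElt_smul c, smul_smul, groupElt_mul_mulElt, mul_smul, groupElt_smul_gen, mulElt_smul]

theorem dunklElt_smul_smul_gen (y : V) (f : Poly V) (u : W) :
    dunklElt c y • f • gen c ρ u = pderiv y f • gen c ρ u -
      ∑ r : Refl G, (c.val r * form r y) • divDiff r f • gen c ρ (ρ r.1 u) := by
  rw [← mulElt_smul c, smul_smul, dunklElt_mul_mulElt, add_smul, mul_smul, dunklElt_smul_gen,
    smul_zero, zero_add, sub_smul, Finset.sum_smul]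
  simp only [smul_assoc, mul_smul, groupElt_smul_gen, mulElt_smul]

theorem eq_top_of_gen_mem {N : Submodule (RCA c) (Standard c ρ)} (hN : ∀ u, gen c ρ u ∈ N) :
    N = ⊤ := by
  rw [eq_top_iff, ← Submodule.range_mkQ (standardRel c ρ), LinearMap.range_eq_map,
    Submodule.map_le_iff_le_comap]
  rintro t -
  induction t using TensorProduct.induction_on with
  | zero => exact zero_mem _
  | tmul T u => exact (smul_gen c ρ T u ▸ N.smul_mem T (hN u) :)
  | add s t hs ht => exact add_mem hs ht

/-- The `ℂ[V]`-linear map `f ⊗ u ↦ f ⊗ u` onto the induced module. -/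
def toStandard : Poly V ⊗[ℂ] W →ₗ[Poly V] Standard c ρ := (gen c ρ).liftBaseChange (Poly V)

@[simp]
theorem toStandard_tmul (f : Poly V) (u : W) : toStandard c ρ (f ⊗ₜ u) = f • gen c ρ u :=
  LinearMap.liftBaseChange_tmul ..

theorem toStandard_surjective : Function.Surjective (toStandard c ρ) := by
  let U := (toStandard c ρ).range
  have gen_mem (f : Poly V) (u : W) : f • gen c ρ u ∈ U := ⟨f ⊗ₜ u, toStandard_tmul c ρ f u⟩
  have stable {T : RCA c} (hT : ∀ (f : Poly V) u, T • f • gen c ρ u ∈ U) (m) (hm : m ∈ U) :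
      T • m ∈ U := by
    obtain ⟨t, rfl⟩ := hm
    induction t using TensorProduct.induction_on with
    | zero => simp only [map_zero, smul_zero, zero_mem]
    | tmul f u => exact (toStandard_tmul c ρ f u).symm ▸ hT f u
    | add s t hs ht => simpa only [map_add, smul_add] using add_mem hs ht
  have hgroup (g : G) := stable (T := groupElt c g) fun f u => by
    rw [groupElt_smul_smul_gen]
    exact gen_mem _ _
  have hdunkl (y : V) := stable (T := dunklElt c y) fun f u => by
    rw [dunklElt_smul_smul_gen]
    refine sub_mem (gen_mem _ _) (sum_mem fun r _ => ?_)
    rw [← smul_assoc]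
    exact gen_mem _ _
  let N : Submodule (RCA c) (Standard c ρ) :=
    { U.toAddSubmonoid with
      smul_mem' := fun T m => smul_mem_of_generators c U.toAddSubmonoid
        (fun f m hm => (mulElt_smul c f m).symm ▸ U.smul_mem f hm) hgroup hdunkl T m }
  have hN : N = ⊤ := eq_top_of_gen_mem c ρ fun u => ⟨1 ⊗ₜ u, by simp⟩
  exact fun m => (hN.ge trivial : m ∈ N)

variable {c ρ} in
theorem standard_hom_ext {E : Type*} [AddCommGroup E] [Module ℂ E]
    {φ ψ : Standard c ρ →ₗ[ℂ] E}
    (h : ∀ (f : Poly V) u, φ (f • gen c ρ u) = ψ (f • gen c ρ u)) : φ = ψ := by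
  have hcomp : φ ∘ₗ (toStandard c ρ).restrictScalars ℂ =
      ψ ∘ₗ (toStandard c ρ).restrictScalars ℂ :=
    TensorProduct.ext' fun f u => by simpa using h f u
  refine LinearMap.ext fun m => ?_
  obtain ⟨t, rfl⟩ := toStandard_surjective c ρ m
  exact LinearMap.congr_fun hcomp t

variable [FiniteDimensional ℂ V]

open Classical in
/-- The `ℂ[V]`-linear map `H_c(G, V) ⊗ W → ℂ[V] ⊗ W`, in curried form, that sends `g ⊗ u` to
`1 ⊗ g u` and `g y^s ⊗ u` to `0` for `s ≠ 0`. -/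
def normalForm : RCA c →ₗ[Poly V] W →ₗ[ℂ] Poly V ⊗[ℂ] W :=
  (pbwBasis c (Module.finBasis ℂ V)).constr (Poly V) fun q =>
    if q.2 = 0 then TensorProduct.mk ℂ (Poly V) W 1 ∘ₗ ρ q.1 else 0

open Classical in
theorem normalForm_pbw (q : G × Multiset (Fin (Module.finrank ℂ V))) :
    normalForm c ρ (pbw c (Module.finBasis ℂ V) q) =
      if q.2 = 0 then TensorProduct.mk ℂ (Poly V) W 1 ∘ₗ ρ q.1 else 0 := by
  have h := (pbwBasis c (Module.finBasis ℂ V)).constr_basis (Poly V)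
    (fun q => if q.2 = 0 then TensorProduct.mk ℂ (Poly V) W 1 ∘ₗ ρ q.1 else 0) q
  rwa [pbwBasis, Module.Basis.mk_apply] at h

theorem normalForm_one : normalForm c ρ 1 = TensorProduct.mk ℂ (Poly V) W 1 := by
  simpa [pbw, groupElt_one, Module.End.one_eq_id] using normalForm_pbw c ρ (1, 0)

theorem normalForm_mul_dunklElt (T : RCA c) (y : V) : normalForm c ρ (T * dunklElt c y) = 0 := by
  have basis_case (q i) : normalForm c ρ (pbw c (Module.finBasis ℂ V) q *
      dunklElt c (Module.finBasis ℂ V i)) = 0 := by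
    rw [pbw, mul_assoc, ← dunklMon_cons']
    exact (normalForm_pbw c ρ (q.1, i ::ₘ q.2)).trans (if_neg Multiset.cons_ne_zero)
  have hT (i) : normalForm c ρ ∘ₗ
      LinearMap.mulRight (Poly V) (dunklElt c (Module.finBasis ℂ V i)) = 0 :=
    (pbwBasis c (Module.finBasis ℂ V)).ext fun q => by simpa [pbwBasis] using basis_case q i
  have hy : (normalForm c ρ).restrictScalars ℂ ∘ₗ LinearMap.mulLeft ℂ T ∘ₗ dunklHom c = 0 :=
    (Module.finBasis ℂ V).ext fun i => LinearMap.congr_fun (hT i) T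
  exact LinearMap.congr_fun hy y

theorem normalForm_mul_groupElt (T : RCA c) (g : G) :
    normalForm c ρ (T * groupElt c g) = normalForm c ρ T ∘ₗ ρ g := by
  have basis_case (q) : normalForm c ρ (pbw c (Module.finBasis ℂ V) q * groupElt c g) =
      normalForm c ρ (pbw c (Module.finBasis ℂ V) q) ∘ₗ ρ g := by
    obtain ⟨k, s⟩ := q
    induction s using Multiset.induction_on with
    | empty =>
      have hmul : pbw c (Module.finBasis ℂ V) (k, 0) * groupElt c g =
          pbw c (Module.finBasis ℂ V) (k * g, 0) := by simp [pbw, groupElt_mul]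
      rw [hmul, normalForm_pbw, normalForm_pbw, if_pos rfl, if_pos rfl, map_mul]
      rfl
    | cons i s _ =>
      rw [normalForm_pbw, if_neg Multiset.cons_ne_zero, LinearMap.zero_comp, pbw, dunklMon_cons',
        mul_assoc, mul_assoc, dunklElt_mul_groupElt, ← mul_assoc, ← mul_assoc,
        normalForm_mul_dunklElt]
  have h : normalForm c ρ ∘ₗ LinearMap.mulRight (Poly V) (groupElt c g) =
      LinearMap.lcomp (Poly V) (Poly V ⊗[ℂ] W) (ρ g) ∘ₗ normalForm c ρ :=
    (pbwBasis c (Module.finBasis ℂ V)).ext fun q => by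
      simpa [pbwBasis, LinearMap.lcomp_apply'] using basis_case q
  exact LinearMap.congr_fun h T

theorem lift_normalForm_smul_eq_zero {t : RCA c ⊗[ℂ] W} (ht : t ∈ standardRel c ρ) (T : RCA c) :
    TensorProduct.AlgebraTensorModule.lift (normalForm c ρ) (T • t) = 0 := by
  induction ht using Submodule.span_induction generalizing T with
  | mem t ht =>
    obtain ⟨g, u, rfl⟩ | ⟨y, u, rfl⟩ := ht
    · simp [smul_sub, TensorProduct.smul_tmul', normalForm_mul_groupElt]
    · simp [TensorProduct.smul_tmul', normalForm_mul_dunklElt]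
  | zero => rw [smul_zero, map_zero]
  | add s t _ _ hs ht => rw [smul_add, map_add, hs, ht, add_zero]
  | smul S t _ ht => rw [smul_smul, ht]

/-- The inverse of `toStandard`. -/
def ofStandard : Standard c ρ →ₗ[Poly V] Poly V ⊗[ℂ] W :=
  ((standardRel c ρ).restrictScalars (Poly V)).liftQ
      (TensorProduct.AlgebraTensorModule.lift (normalForm c ρ))
      (fun t ht => by simpa using lift_normalForm_smul_eq_zero c ρ ht 1) ∘ₗ
    (Submodule.Quotient.restrictScalarsEquiv (Poly V) (standardRel c ρ)).symm.toLinearMap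

theorem ofStandard_smul_gen (f : Poly V) (u : W) : ofStandard c ρ (f • gen c ρ u) = f ⊗ₜ u := by
  have hgen : ofStandard c ρ (gen c ρ u) = 1 ⊗ₜ u := by
    change TensorProduct.AlgebraTensorModule.lift (normalForm c ρ) (1 ⊗ₜ u) = _
    rw [TensorProduct.AlgebraTensorModule.lift_tmul, normalForm_one, TensorProduct.mk_apply]
  rw [map_smul, hgen, TensorProduct.smul_tmul', smul_eq_mul, mul_one]

/-- The fibre of `Δ_c(W)` at `v`: the map `f ⊗ u ↦ f(v) u`. -/
def evalStd (v : V) : Standard c ρ →ₗ[ℂ] W :=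
  TensorProduct.lid ℂ W ∘ₗ (polyEval v).toLinearMap.rTensor W ∘ₗ
    (ofStandard c ρ).restrictScalars ℂ

theorem evalStd_smul_gen (v : V) (f : Poly V) (u : W) :
    evalStd c ρ v (f • gen c ρ u) = polyEval v f • u := by
  simp only [evalStd, LinearMap.comp_apply, LinearMap.restrictScalars_apply, ofStandard_smul_gen]
  simp

theorem evalStd_smul (v : V) (f : Poly V) (m : Standard c ρ) :
    evalStd c ρ v (f • m) = polyEval v f • evalStd c ρ v m := by
  suffices h : evalStd c ρ v ∘ₗ Algebra.lsmul ℂ ℂ (Standard c ρ) f =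
      polyEval v f • evalStd c ρ v from LinearMap.congr_fun h m
  refine standard_hom_ext fun h u => ?_
  simp [smul_smul, evalStd_smul_gen]

theorem evalStd_groupElt_smul {v : V} {g : G} (hg : (g : V ≃ₗ[ℂ] V) v = v) (m : Standard c ρ) :
    evalStd c ρ v (groupElt c g • m) = ρ g (evalStd c ρ v m) := by
  suffices h : evalStd c ρ v ∘ₗ Algebra.lsmul ℂ ℂ (Standard c ρ) (groupElt c g) =
      ρ g ∘ₗ evalStd c ρ v from LinearMap.congr_fun h m
  have hg' : (g : V ≃ₗ[ℂ] V)⁻¹ v = v := (LinearEquiv.symm_apply_eq _).2 hg.symm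
  refine standard_hom_ext fun f u => ?_
  simp [groupElt_smul_smul_gen, evalStd_smul_gen, polyEval_polyAct, hg']

theorem jacobson_ne_top [FiniteDimensional ℂ W] [Nontrivial W] :
    Module.jacobson (RCA c) (Standard c ρ) ≠ ⊤ := by
  have : Nontrivial (Standard c ρ) := by
    obtain ⟨u, hu⟩ := exists_ne (0 : W)
    refine ⟨gen c ρ u, 0, fun h => hu ?_⟩
    simpa [h] using (evalStd_smul_gen c ρ 0 1 u).symm
  obtain ⟨N, hN⟩ := IsCoatomic.exists_coatom (Submodule (RCA c) (Standard c ρ))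
  exact fun h => hN.1 (top_le_iff.1 (h ▸ sInf_le hN))

end Standard

section Layers

variable {V : Type*} [AddCommGroup V] [Module ℂ V] {G : Subgroup (V ≃ₗ[ℂ] V)} [Finite G]
  (c : Param G) {W : Type*} [AddCommGroup W] [Module ℂ W] (ρ : Representation ℂ G W)

/-- The action of `G` on `Δ_c(W)`. -/
def stdRep : Representation ℂ G (Standard c ρ) where
  toFun g := Algebra.lsmul ℂ ℂ (Standard c ρ) (groupElt c g)
  map_one' := by rw [groupElt_one, map_one]
  map_mul' g h := by rw [groupElt_mul, map_mul]

theorem stdRep_apply (g : G) (m : Standard c ρ) : stdRep c ρ g m = groupElt c g • m := rfl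

/-- The part `ℂ[V]_d ⊗ W` of degree `d` of `Δ_c(W)`. -/
def stdHomog (d : ℕ) : Submodule ℂ (Standard c ρ) := homog V d • LinearMap.range (gen c ρ)

theorem stdHomog_zero : stdHomog c ρ 0 = LinearMap.range (gen c ρ) := by
  rw [stdHomog, homog, pow_zero, Submodule.one_smul]

theorem stdHomog_fg [FiniteDimensional ℂ V] [FiniteDimensional ℂ W] (d : ℕ) :
    (stdHomog c ρ d).FG := by
  have h := (homog_fg (V := V) d).map₂ (Algebra.lsmul ℂ ℂ (Standard c ρ)).toLinearMap
    (Module.Finite.fg_top.map (gen c ρ))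
  refine h.of_le (Submodule.smul_le.2 fun f hf m hm => Submodule.apply_mem_map₂ _ hf ?_)
  rwa [← LinearMap.range_eq_map]

variable {c ρ}

theorem smul_gen_mem_stdHomog {d : ℕ} {f : Poly V} (hf : f ∈ homog V d) (u : W) :
    f • gen c ρ u ∈ stdHomog c ρ d :=
  Submodule.smul_mem_smul hf ⟨u, rfl⟩

@[elab_as_elim]
theorem stdHomog_induction {p : Standard c ρ → Prop} {d : ℕ}
    (smul_gen : ∀ f ∈ homog V d, ∀ u, p (f • gen c ρ u)) (add : ∀ m n, p m → p n → p (m + n))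
    {m : Standard c ρ} (hm : m ∈ stdHomog c ρ d) : p m :=
  Submodule.smul_induction_on hm (fun f hf _ ⟨u, hu⟩ => hu ▸ smul_gen f hf u) add

theorem groupElt_smul_mem_stdHomog (g : G) {d : ℕ} {m : Standard c ρ} (hm : m ∈ stdHomog c ρ d) :
    groupElt c g • m ∈ stdHomog c ρ d := by
  refine stdHomog_induction (fun f hf u => ?_) (fun m n hm hn => ?_) hm
  · rw [groupElt_smul_smul_gen]
    exact smul_gen_mem_stdHomog (polyAct_mem_homog _ hf) _
  · exact smul_add (groupElt c g) m n ▸ add_mem hm hn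

theorem coord_smul_mem_stdHomog (x : Module.Dual ℂ V) {d : ℕ} {m : Standard c ρ}
    (hm : m ∈ stdHomog c ρ d) : coord x • m ∈ stdHomog c ρ (d + 1) := by
  refine stdHomog_induction (fun f hf u => ?_) (fun m n hm hn => ?_) hm
  · rw [smul_smul]
    exact smul_gen_mem_stdHomog (coord_mul_mem_homog x hf) u
  · exact smul_add (coord x) m n ▸ add_mem hm hn

theorem dunklElt_smul_mem_stdHomog (y : V) {d : ℕ} {m : Standard c ρ}
    (hm : m ∈ stdHomog c ρ (d + 1)) : dunklElt c y • m ∈ stdHomog c ρ d := by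
  refine stdHomog_induction (fun f hf u => ?_) (fun m n hm hn => ?_) hm
  · rw [dunklElt_smul_smul_gen]
    exact sub_mem (smul_gen_mem_stdHomog (pderiv_mem_homog y hf) u) (sum_mem fun r _ =>
      Submodule.smul_mem _ _ (smul_gen_mem_stdHomog (divDiff_mem_homog r hf) _))
  · exact smul_add (dunklElt c y) m n ▸ add_mem hm hn

section Euler

variable {ι : Type*} [Fintype ι] (b : Module.Basis ι ℂ V)

variable (c) in
/-- The Euler element `∑ᵢ xᵢ yᵢ + ∑_r c_r (1 - r)` of `H_c(G, V)`, for dual bases `x` of `V*` and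
`y` of `V`. It grades the standard modules. -/
def eulerElt : RCA c :=
  ∑ i, mulElt c (coord (b.coord i)) * dunklElt c (b i) +
    ∑ r : Refl G, c.val r • (1 - groupElt c r.1)

theorem eulerElt_smul (m : Standard c ρ) :
    eulerElt c b • m =
      ∑ i, coord (b.coord i) • dunklElt c (b i) • m + reflSum c (stdRep c ρ) m := by
  simp only [eulerElt, reflSum, add_smul, Finset.sum_smul, mul_smul, mulElt_smul, sub_smul,
    one_smul, smul_assoc, LinearMap.sum_apply, LinearMap.smul_apply, LinearMap.sub_apply,
    Module.End.one_apply, stdRep_apply]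

theorem sum_coord_smul_dunklElt_smul_gen {d : ℕ} {f : Poly V} (hf : f ∈ homog V d) (u : W) :
    ∑ i, coord (b.coord i) • dunklElt c (b i) • f • gen c ρ u = (d : ℂ) • f • gen c ρ u -
      ∑ r : Refl G, c.val r • (f - polyAct (r.1 : V ≃ₗ[ℂ] V) f) • gen c ρ (ρ r.1 u) := by
  have hrefl (r : Refl G) : ∑ i, coord (b.coord i) • (c.val r * form r (b i)) •
      divDiff r f • gen c ρ (ρ r.1 u) =
        c.val r • (f - polyAct (r.1 : V ≃ₗ[ℂ] V) f) • gen c ρ (ρ r.1 u) := by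
    rw [← form_mul_divDiff, ← sum_smul_coord b, mul_smul, Finset.sum_smul, Finset.smul_sum]
    exact Finset.sum_congr rfl fun i _ => by rw [smul_comm, mul_smul, smul_assoc]
  simp only [dunklElt_smul_smul_gen, smul_sub, Finset.smul_sum, Finset.sum_sub_distrib]
  rw [Finset.sum_comm, Finset.sum_congr rfl fun r _ => hrefl r]
  simp only [smul_smul, ← Finset.sum_smul, sum_coord_mul_pderiv b hf, smul_assoc]

theorem eulerElt_smul_of_mem_stdHomog {κ : ℂ} (hκ : reflSum c ρ = κ • 1) {d : ℕ}
    {m : Standard c ρ} (hm : m ∈ stdHomog c ρ d) : eulerElt c b • m = (κ + d) • m := by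
  refine stdHomog_induction (fun f hf u => ?_)
    (fun m n hm hn => by rw [smul_add, hm, hn, smul_add]) hm
  have hu : f • gen c ρ (reflSum c ρ u) = κ • f • gen c ρ u := by
    rw [hκ, LinearMap.smul_apply, map_smul, smul_comm, Module.End.one_apply]
  rw [eulerElt_smul, sum_coord_smul_dunklElt_smul_gen b hf]
  simp only [reflSum, LinearMap.sum_apply, LinearMap.smul_apply, LinearMap.sub_apply,
    Module.End.one_apply, stdRep_apply, groupElt_smul_smul_gen, map_sum, map_smul, map_sub,
    add_smul, sub_smul, smul_sub, Finset.sum_sub_distrib, Finset.smul_sum] at hu ⊢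
  rw [← hu]
  simp only [smul_comm f]
  abel

end Euler

variable (N : Submodule (RCA c) (Standard c ρ))

/-- The part of degree `d` of a submodule of `Δ_c(W)`, a representation of `G`. -/
def layer (d : ℕ) : Subrepresentation (stdRep c ρ) where
  toSubmodule := N.restrictScalars ℂ ⊓ stdHomog c ρ d
  apply_mem_toSubmodule g _ hm := ⟨N.smul_mem _ hm.1, groupElt_smul_mem_stdHomog g hm.2⟩

variable {N}

theorem coord_smul_mem_layer (x : Module.Dual ℂ V) {d : ℕ} {m : Standard c ρ}
    (hm : m ∈ layer N d) : coord x • m ∈ layer N (d + 1) :=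
  ⟨mulElt_smul c (coord x) m ▸ N.smul_mem _ hm.1, coord_smul_mem_stdHomog x hm.2⟩

theorem dunklElt_smul_mem_layer (y : V) {d : ℕ} {m : Standard c ρ} (hm : m ∈ layer N (d + 1)) :
    dunklElt c y • m ∈ layer N d :=
  ⟨N.smul_mem _ hm.1, dunklElt_smul_mem_stdHomog y hm.2⟩

theorem layer_fg [FiniteDimensional ℂ V] [FiniteDimensional ℂ W] (d : ℕ) :
    (layer N d).toSubmodule.FG :=
  (stdHomog_fg c ρ d).of_le inf_le_right

theorem eq_zero_of_mem_layer_zero (hρ : ρ.IsIrreducible) (hN : N ≠ ⊤) {m : Standard c ρ}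
    (hm : m ∈ layer N 0) : m = 0 := by
  let S : Subrepresentation ρ :=
    { toSubmodule := (N.restrictScalars ℂ).comap (gen c ρ)
      apply_mem_toSubmodule := fun g u hu => by
        rw [Submodule.mem_comap, ← groupElt_smul_gen]
        exact N.smul_mem _ hu }
  have hS : S = ⊥ := (hρ.eq_bot_or_eq_top S).resolve_right fun h =>
    hN (eq_top_of_gen_mem c ρ fun u => (h ▸ trivial : u ∈ S))
  obtain ⟨u, rfl⟩ : m ∈ LinearMap.range (gen c ρ) := stdHomog_zero c ρ ▸ hm.2
  have hu : u ∈ (⊥ : Subrepresentation ρ) := hS ▸ hm.1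
  rw [(Submodule.mem_bot ℂ).1 hu, map_zero]

variable [FiniteDimensional ℂ V]

theorem exists_stdHomog_le {κ : ℂ} (hκ : reflSum c ρ = κ • 1)
    (hN : FiniteDimensional ℂ (Standard c ρ ⧸ N)) :
    ∃ d, stdHomog c ρ d ≤ N.restrictScalars ℂ := by
  let φ : Module.End ℂ (Standard c ρ ⧸ N) :=
    Algebra.lsmul ℂ ℂ _ (eulerElt c (Module.finBasis ℂ V))
  obtain ⟨d, hd⟩ : ∃ d : ℕ, ¬ φ.HasEigenvalue (κ + d) := by
    by_contra! h
    have hinj : Function.Injective fun d : ℕ => κ + (d : ℂ) :=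
      (add_right_injective κ).comp Nat.cast_injective
    exact Set.infinite_range_of_injective hinj
      ((Module.End.finite_hasEigenvalue φ).subset (Set.range_subset_iff.2 h))
  refine ⟨d, fun m hm => (Submodule.Quotient.mk_eq_zero N).1 ?_⟩
  have hφ : N.mkQ m ∈ φ.eigenspace (κ + d) :=
    Module.End.mem_eigenspace_iff.2 (congrArg N.mkQ (eulerElt_smul_of_mem_stdHomog _ hκ hm))
  by_contra h
  exact hd (Module.End.hasEigenvalue_of_hasEigenvector ⟨hφ, h⟩)

end Layers

section Subrepresentations

open Representation

variable {k K T : Type*} [Field k] [Group K] [AddCommGroup T] [Module k T]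
  {τ : Representation k K T}

theorem nontrivial_of_isIrreducible (hτ : τ.IsIrreducible) : Nontrivial T := by
  by_contra h
  rw [not_nontrivial_iff_subsingleton] at h
  exact bot_ne_top (α := Subrepresentation τ)
    (Subrepresentation.toSubmodule_injective (Subsingleton.elim _ _))

theorem exists_subrepresentation_of_not_isIrreducible [Nontrivial T] (hτ : ¬ τ.IsIrreducible) :
    ∃ S : Subrepresentation τ, S ≠ ⊥ ∧ S ≠ ⊤ := by
  by_contra! h
  have : Nontrivial (Subrepresentation τ) :=
    ⟨⊥, ⊤, fun h => bot_ne_top (α := Submodule k T) (congrArg (·.toSubmodule) h)⟩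
  exact hτ ⟨fun S => or_iff_not_imp_left.2 (h S)⟩

theorem exists_fdRep_equiv {T : Type*} [AddCommGroup T] [Module ℂ T] [FiniteDimensional ℂ T]
    (τ : Representation ℂ K T) : ∃ X : FDRep ℂ K, Nonempty (τ.Equiv X.ρ) := by
  let e := (Module.finBasis ℂ T).equivFun
  let σ : Representation ℂ K (Fin (Module.finrank ℂ T) → ℂ) :=
    (e.conjRingEquiv : Module.End ℂ T →* _).comp τ
  refine ⟨FDRep.of σ, ⟨.mk e fun g => LinearMap.ext fun t => ?_⟩⟩
  exact congrArg (fun u => e (τ g u)) (e.symm_apply_apply t).symm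

/-- An intertwining map, as a map onto its range. -/
def rangeRestrict {T' : Type*} [AddCommGroup T'] [Module k T'] {τ' : Representation k K T'}
    (f : IntertwiningMap τ τ') :
    IntertwiningMap τ (IntertwiningMap.range τ τ' f).toRepresentation :=
  ⟨f.toLinearMap.rangeRestrict, fun g => LinearMap.ext fun t =>
    Subtype.ext (IntertwiningMap.isIntertwining τ τ' f g t)⟩

variable (S : Subrepresentation τ)

/-- The quotient of a representation by a subrepresentation. -/
abbrev quotientRep : Representation k K (T ⧸ S.toSubmodule) :=
  τ.quotient S.toSubmodule S.apply_mem_toSubmodule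

/-- The inclusion of a subrepresentation. -/
def inclusionMap : IntertwiningMap S.toRepresentation τ := ⟨S.toSubmodule.subtype, fun _ => rfl⟩

/-- The projection onto the quotient by a subrepresentation. -/
def quotientMap : IntertwiningMap τ (quotientRep S) := ⟨S.toSubmodule.mkQ, fun _ => rfl⟩

theorem exact_inclusionMap_quotientMap : Function.Exact (inclusionMap S) (quotientMap S) :=
  LinearMap.exact_subtype_mkQ S.toSubmodule

theorem quotientMap_surjective : Function.Surjective (quotientMap S) :=
  S.toSubmodule.mkQ_surjective

end Subrepresentations

section SerreClass

open Representation

variable {K : Type*} [Group K]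

/-- The morphism of `FDRep ℂ K` given by an intertwining map. -/
def homOfIntertwining {X Y : FDRep ℂ K} (f : IntertwiningMap X.ρ Y.ρ) : X ⟶ Y where
  hom := FGModuleCat.ofHom f.toLinearMap
  comm g := by
    ext x
    exact IntertwiningMap.isIntertwining _ _ f g x

variable {P : ObjectProperty (FDRep ℂ K)} [P.IsSerreClass] {X Y Z : FDRep ℂ K}

theorem prop_of_surjective (f : IntertwiningMap X.ρ Y.ρ) (hf : Function.Surjective f)
    (hX : P X) : P Y := by
  have : Epi (homOfIntertwining f) := ConcreteCategory.epi_of_surjective _ hf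
  exact P.prop_of_epi (homOfIntertwining f) hX

theorem prop_of_exact (f : IntertwiningMap X.ρ Y.ρ) (e : IntertwiningMap Y.ρ Z.ρ)
    (h : Function.Exact f e) (hX : P X) (hZ : P Z) : P Y := by
  let S : ShortComplex (FDRep ℂ K) :=
    ShortComplex.mk (homOfIntertwining f) (homOfIntertwining e) (by
      ext x
      exact h.apply_apply_eq_zero x)
  refine P.prop_X₂_of_exact (S := S) ?_ hX hZ
  rw [← S.exact_map_iff_of_faithful
    (Action.forget (FGModuleCat ℂ) K ⋙ forget₂ (FGModuleCat ℂ) (ModuleCat ℂ)),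
    ShortComplex.moduleCat_exact_iff_range_eq_ker]
  exact (LinearMap.exact_iff.1 h).symm

theorem prop_res_of_exact {K : Type*} [Group K] {H : Subgroup K} {P : ObjectProperty (FDRep ℂ H)}
    [P.IsSerreClass] {X Y Z : FDRep ℂ K} (f : IntertwiningMap X.ρ Y.ρ)
    (e : IntertwiningMap Y.ρ Z.ρ) (h : Function.Exact f e) (hX : P (res H X))
    (hZ : P (res H Z)) : P (res H Y) :=
  prop_of_exact (X := res H X) (Y := res H Y) (Z := res H Z)
    ⟨f.toLinearMap, fun h => f.isIntertwining' h⟩ ⟨e.toLinearMap, fun h => e.isIntertwining' h⟩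
    h hX hZ

theorem prop_of_subsingleton [Subsingleton X] : P X := by
  apply P.prop_of_isZero
  rw [Limits.IsZero.iff_id_eq_zero]
  ext x
  exact Subsingleton.elim (α := X) _ _

end SerreClass

section ReflectionSum

open Representation

variable {V : Type*} [AddCommGroup V] [Module ℂ V] {G : Subgroup (V ≃ₗ[ℂ] V)} [Finite G]
  (c : Param G)

section

variable {T T' : Type*} [AddCommGroup T] [Module ℂ T] [AddCommGroup T'] [Module ℂ T']
  {τ : Representation ℂ G T} {τ' : Representation ℂ G T'}

theorem map_reflSum (f : IntertwiningMap τ τ') (t : T) :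
    f (reflSum c τ t) = reflSum c τ' (f t) := by
  simp [reflSum, LinearMap.sum_apply, f.isIntertwining]

theorem reflSum_eq_smul_one_of_injective {κ : ℂ} (f : IntertwiningMap τ τ')
    (hf : Function.Injective f) (hκ : reflSum c τ' = κ • 1) : reflSum c τ = κ • 1 :=
  LinearMap.ext fun t => hf <| by
    rw [map_reflSum, hκ]
    exact (map_smul f κ t).symm

theorem reflSum_eq_smul_one_of_surjective {κ : ℂ} (f : IntertwiningMap τ τ')
    (hf : Function.Surjective f) (hκ : ∀ t, f (reflSum c τ t) = κ • f t) :
    reflSum c τ' = κ • 1 :=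
  LinearMap.ext fun t' => by
    obtain ⟨t, rfl⟩ := hf t'
    exact (map_reflSum c f t).symm.trans (hκ t)

end

variable {c} {H : Subgroup G} {P : ObjectProperty (FDRep ℂ H)} [P.IsSerreClass] {κ : ℂ}

theorem prop_res_of_reflSum_eq
    (hP : ∀ (X : FDRep ℂ G) (hX : Representation.IsIrreducible X.ρ),
      cValue c X.ρ hX = κ → P (res H X))
    (X : FDRep ℂ G) (hX : reflSum c X.ρ = κ • 1) : P (res H X) := by
  induction hn : Module.finrank ℂ X using Nat.strong_induction_on generalizing X with
  | _ n ih =>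
  rcases subsingleton_or_nontrivial X with _ | _
  · have : Subsingleton (res H X) := ‹_›
    exact prop_of_subsingleton
  by_cases hirr : Representation.IsIrreducible X.ρ
  · refine hP X hirr (smul_left_injective ℂ (one_ne_zero (α := Module.End ℂ X)) ?_)
    exact (cValue_spec c X.ρ hirr).symm.trans hX
  obtain ⟨S, hbot, htop⟩ := exists_subrepresentation_of_not_isIrreducible hirr
  have hlt : Module.finrank ℂ S.toSubmodule < n :=
    hn ▸ Submodule.finrank_lt fun h => htop (Subrepresentation.toSubmodule_injective h)
  have hlt' : Module.finrank ℂ (X ⧸ S.toSubmodule) < n := by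
    have hpos : 1 ≤ Module.finrank ℂ S.toSubmodule :=
      Submodule.one_le_finrank_iff.2 fun h => hbot (Subrepresentation.toSubmodule_injective h)
    have hadd := S.toSubmodule.finrank_quotient_add_finrank
    omega
  refine prop_res_of_exact (X := FDRep.of S.toRepresentation) (Z := FDRep.of (quotientRep S))
    (inclusionMap S) (quotientMap S) (exact_inclusionMap_quotientMap S)
    (ih _ hlt _ ?_ rfl) (ih _ hlt' (FDRep.of (quotientRep S)) ?_ rfl)
  · exact reflSum_eq_smul_one_of_injective c (inclusionMap S) Subtype.val_injective hX
  · exact reflSum_eq_smul_one_of_surjective c (quotientMap S) (quotientMap_surjective S) fun t => by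
      rw [hX]
      exact map_smul (quotientMap S) κ t

variable {T : Type*} [AddCommGroup T] [Module ℂ T] [FiniteDimensional ℂ T]
    {τ : Representation ℂ G T} {Y : FDRep ℂ H}

theorem prop_of_surjective_of_reflSum_eq
    (hP : ∀ (X : FDRep ℂ G) (hX : Representation.IsIrreducible X.ρ),
      cValue c X.ρ hX = κ → P (res H X)) (hτ : reflSum c τ = κ • 1)
    (f : IntertwiningMap (τ.comp H.subtype) Y.ρ) (hf : Function.Surjective f) : P Y := by
  obtain ⟨X, ⟨e⟩⟩ := exists_fdRep_equiv τ
  have hX : reflSum c X.ρ = κ • 1 :=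
    reflSum_eq_smul_one_of_injective c e.symm.toIntertwiningMap e.symm.injective hτ
  let e' : IntertwiningMap (res H X).ρ (τ.comp H.subtype) :=
    ⟨e.symm.toLinearMap, fun h => e.symm.isIntertwining' h⟩
  exact prop_of_surjective (X := res H X) (f.comp e') (hf.comp e.symm.surjective)
    (prop_res_of_reflSum_eq hP X hX)

theorem prop_of_surjective_of_map_reflSum
    (hP : ∀ (X : FDRep ℂ G) (hX : Representation.IsIrreducible X.ρ),
      cValue c X.ρ hX = κ → P (res H X))
    (f : IntertwiningMap (τ.comp H.subtype) Y.ρ)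
    (hf : Function.Surjective f) (hκ : ∀ t, f (reflSum c τ t) = κ • f t) : P Y := by
  let D : Subrepresentation τ := IntertwiningMap.range τ τ
    (⟨reflSum c τ, reflSum_comm c τ⟩ - κ • IntertwiningMap.id τ)
  have hD : D.toSubmodule ≤ LinearMap.ker f.toLinearMap := by
    rintro _ ⟨t, rfl⟩
    exact (map_sub f _ _).trans (sub_eq_zero.2 ((hκ t).trans (map_smul f κ t).symm))
  have hq : reflSum c (quotientRep D) = κ • 1 :=
    reflSum_eq_smul_one_of_surjective c (quotientMap D) (quotientMap_surjective D) fun t =>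
      ((Submodule.Quotient.eq D.toSubmodule).2 ⟨t, rfl⟩).trans (map_smul (quotientMap D) κ t)
  let f' : IntertwiningMap ((quotientRep D).comp H.subtype) Y.ρ :=
    ⟨D.toSubmodule.liftQ f.toLinearMap hD, fun h =>
      D.toSubmodule.linearMap_qext (f.isIntertwining' h)⟩
  refine prop_of_surjective_of_reflSum_eq hP hq f' fun y => ?_
  obtain ⟨t, rfl⟩ := hf y
  exact ⟨quotientMap D t, rfl⟩

end ReflectionSum

section Fibre

open Representation

variable {V : Type*} [AddCommGroup V] [Module ℂ V] [FiniteDimensional ℂ V]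
  {G : Subgroup (V ≃ₗ[ℂ] V)} [Finite G] {c : Param G}
  {W : Type*} [AddCommGroup W] [Module ℂ W] {ρ : Representation ℂ G W}
  (N : Submodule (RCA c) (Standard c ρ)) (v : V)

/-- Evaluation at `v` on the part of degree `d` of a submodule of `Δ_c(W) = ℂ[V] ⊗ W`. -/
def evalLayer (d : ℕ) :
    IntertwiningMap ((layer N d).toRepresentation.comp (MulAction.stabilizer G v).subtype)
      (ρ.comp (MulAction.stabilizer G v).subtype) where
  toLinearMap := evalStd c ρ v ∘ₗ (layer N d).toSubmodule.subtype
  isIntertwining' g := LinearMap.ext fun m => evalStd_groupElt_smul c ρ g.2 m.1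

/-- The values at `v` of the elements of degree `d` of a submodule of `Δ_c(W) = ℂ[V] ⊗ W`. -/
def fibre (d : ℕ) : Subrepresentation (ρ.comp (MulAction.stabilizer G v).subtype) :=
  IntertwiningMap.range _ _ (evalLayer N v d)

variable {N v}

theorem evalStd_mem_fibre {d : ℕ} {m : Standard c ρ} (hm : m ∈ layer N d) :
    evalStd c ρ v m ∈ fibre N v d :=
  ⟨⟨m, hm⟩, rfl⟩

theorem evalStd_coord_smul_mem_fibre (x : Module.Dual ℂ V) {d : ℕ} {m : Standard c ρ}
    (hm : m ∈ layer N d) : evalStd c ρ v (coord x • m) ∈ fibre N v d := by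
  rw [evalStd_smul]
  exact (fibre N v d).toSubmodule.smul_mem _ (evalStd_mem_fibre hm)

theorem fibre_le_succ (hv : v ≠ 0) (d : ℕ) : fibre N v d ≤ fibre N v (d + 1) := by
  obtain ⟨x, hx⟩ := not_forall.1 (mt (Module.forall_dual_apply_eq_zero_iff ℂ v).1 hv)
  rintro _ ⟨m, rfl⟩
  have h := (fibre N v (d + 1)).toSubmodule.smul_mem (x v)⁻¹
    (evalStd_mem_fibre (coord_smul_mem_layer x m.2))
  rwa [evalStd_smul, polyEval_coord, inv_smul_smul₀ hx] at h

theorem evalStd_reflSum_sub_mem_fibre {κ : ℂ} (hκ : reflSum c ρ = κ • 1) {d : ℕ}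
    {m : Standard c ρ} (hm : m ∈ layer N (d + 1)) :
    evalStd c ρ v (reflSum c (stdRep c ρ) m - (κ + (d + 1 : ℕ)) • m) ∈ fibre N v d := by
  have h := eulerElt_smul (Module.finBasis ℂ V) m
  rw [eulerElt_smul_of_mem_stdHomog _ hκ hm.2] at h
  rw [h, sub_add_cancel_right, map_neg, map_sum]
  exact (fibre N v d).toSubmodule.neg_mem (Submodule.sum_mem _ fun i _ =>
    evalStd_coord_smul_mem_fibre _ (dunklElt_smul_mem_layer _ hm))

theorem exists_fibre_eq_top {κ : ℂ} (hκ : reflSum c ρ = κ • 1)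
    (hN : FiniteDimensional ℂ (Standard c ρ ⧸ N)) (hv : v ≠ 0) : ∃ d, fibre N v d = ⊤ := by
  obtain ⟨x, hx⟩ := not_forall.1 (mt (Module.forall_dual_apply_eq_zero_iff ℂ v).1 hv)
  obtain ⟨d, hd⟩ := exists_stdHomog_le hκ hN
  refine ⟨d, top_unique fun u _ => ?_⟩
  have hmem : coord x ^ d • gen c ρ ((x v ^ d)⁻¹ • u) ∈ stdHomog c ρ d :=
    smul_gen_mem_stdHomog (Submodule.pow_mem_pow _ (LinearMap.mem_range_self coord x) d) _
  have h := evalStd_mem_fibre (v := v) (N := N) ⟨hd hmem, hmem⟩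
  rwa [evalStd_smul_gen, map_pow, polyEval_coord, smul_inv_smul₀ (pow_ne_zero d hx)] at h

end Fibre

section FibreSerreClass

open Representation

variable {V : Type*} [AddCommGroup V] [Module ℂ V] [FiniteDimensional ℂ V]
  {G : Subgroup (V ≃ₗ[ℂ] V)} [Finite G] {c : Param G} {W : Type} [AddCommGroup W] [Module ℂ W]
  [FiniteDimensional ℂ W] {ρ : Representation ℂ G W} {N : Submodule (RCA c) (Standard c ρ)} {v : V}
  {P : ObjectProperty (FDRep ℂ (MulAction.stabilizer G v))} [P.IsSerreClass]

theorem prop_fibre_succ (hv : v ≠ 0) {κ : ℂ} (hκ : reflSum c ρ = κ • 1) {d : ℕ}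
    (hP : ∀ (X : FDRep ℂ G) (hX : Representation.IsIrreducible X.ρ),
      cValue c X.ρ hX = κ + (d + 1 : ℕ) → P (res (MulAction.stabilizer G v) X))
    (hd : P (FDRep.of (fibre N v d).toRepresentation)) :
    P (FDRep.of (fibre N v (d + 1)).toRepresentation) := by
  have := Module.Finite.iff_fg.2 (layer_fg (N := N) (d + 1))
  let i : IntertwiningMap (fibre N v d).toRepresentation (fibre N v (d + 1)).toRepresentation :=
    ⟨Submodule.inclusion (fibre_le_succ hv d), fun _ => rfl⟩
  let Q := IntertwiningMap.range _ _ i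
  let f : IntertwiningMap
      ((layer N (d + 1)).toRepresentation.comp (MulAction.stabilizer G v).subtype)
      (FDRep.of (quotientRep Q)).ρ :=
    (quotientMap Q).comp (rangeRestrict (evalLayer N v (d + 1)))
  have hf : Function.Surjective f := (quotientMap_surjective Q).comp
    (evalLayer N v (d + 1)).toLinearMap.surjective_rangeRestrict
  refine prop_of_exact (Z := FDRep.of (quotientRep Q)) i (quotientMap Q)
    (LinearMap.exact_map_mkQ_range i.toLinearMap) hd
    (prop_of_surjective_of_map_reflSum hP f hf fun m => ?_)
  have hm := evalStd_reflSum_sub_mem_fibre (v := v) hκ m.2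
  have hsub : (reflSum c (layer N (d + 1)).toRepresentation m).1 = reflSum c (stdRep c ρ) m.1 :=
    map_reflSum c (inclusionMap (layer N (d + 1))) m
  refine (Submodule.Quotient.eq Q.toSubmodule).2 ⟨⟨_, hm⟩, Subtype.ext ?_⟩
  change evalStd c ρ v _ = evalStd c ρ v _ - (κ + (d + 1 : ℕ)) • evalStd c ρ v m.1
  rw [map_sub, map_smul, ← hsub]
  rfl

theorem prop_fibre (hρ : ρ.IsIrreducible)
    (hP : ∀ (T : FDRep ℂ G) (hT : Representation.IsIrreducible T.ρ),
      (∃ n : ℕ, 0 < n ∧ cValue c T.ρ hT - cValue c ρ hρ = n) →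
        P (res (MulAction.stabilizer G v) T))
    (hN : N ≠ ⊤) (hv : v ≠ 0) (d : ℕ) : P (FDRep.of (fibre N v d).toRepresentation) := by
  induction d with
  | zero =>
    have : Subsingleton (fibre N v 0).toSubmodule := by
      refine subsingleton_of_forall_eq 0 ?_
      rintro ⟨_, m, rfl⟩
      have : m = 0 := Subtype.ext (eq_zero_of_mem_layer_zero hρ hN m.2)
      exact Subtype.ext (this ▸ map_zero (evalLayer N v 0))
    exact prop_of_subsingleton (X := FDRep.of _)
  | succ d ih =>
    refine prop_fibre_succ hv (cValue_spec c ρ hρ)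
      (fun X hX h => hP X hX ⟨d + 1, d.succ_pos, ?_⟩) ih
    rw [h, add_sub_cancel_left]

end FibreSerreClass

end Cherednik

end

theorem mainTheorem2 {V : Type*} [AddCommGroup V] [Module ℂ V] [FiniteDimensional ℂ V]
    (G : Subgroup (V ≃ₗ[ℂ] V)) [Finite G] (c : Cherednik.Param G)
    (S : FDRep ℂ G) (hS : Representation.IsIrreducible S.ρ)
    (hL : FiniteDimensional ℂ (Cherednik.Irred c S.ρ)) (v : V) (hv : v ≠ 0) :
    Cherednik.serreClosure
      (fun X : FDRep ℂ (MulAction.stabilizer G v) =>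
        ∃ (T : FDRep ℂ G) (hT : Representation.IsIrreducible T.ρ),
          (∃ n : ℕ, 0 < n ∧ Cherednik.cValue c T.ρ hT - Cherednik.cValue c S.ρ hS = n) ∧
          X = Cherednik.res (MulAction.stabilizer G v) T)
      (Cherednik.res (MulAction.stabilizer G v) S) := by
  intro P _ hQ
  have := Cherednik.nontrivial_of_isIrreducible hS
  obtain ⟨d, hd⟩ := Cherednik.exists_fibre_eq_top (Cherednik.cValue_spec c S.ρ hS) hL hv
  have hP := Cherednik.prop_fibre hS (fun T hT h => hQ _ ⟨T, hT, h, rfl⟩)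
    (Cherednik.jacobson_ne_top c S.ρ) hv d
  refine Cherednik.prop_of_surjective (Y := Cherednik.res (MulAction.stabilizer G v) S)
    (Cherednik.inclusionMap _) (fun u => ?_) hP
  exact ⟨⟨u, hd ▸ Submodule.mem_top⟩, rfl⟩
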